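/- **Classical side.** Let $\langle M,P(\mathbf u)\rangle$ be a probabilistic structural causal model (PSM): finitely many endogenous variables $V_i$ and exogenous variables $U_i$, all with finitely many values, structural functions $v_i=f_i(u_i,pa_i)$ with $Pa_i\subseteq\mathbf V$ forming a directed acyclic graph, and a probability distribution $P(\mathbf u)$ on the joint exogenous values. For $\mathbf X,\mathbf Y,\mathbf E\subseteq\mathbf V$, let $\mathbf Y_{\mathbf x}(\mathbf u)$ be the value of $\mathbf Y$ in the solution of the equations in which those of $\mathbf X$ are replaced by $\mathbf X=\mathbf x$, and $\mathbf E(\mathbf u)$ the value of $\mathbf E$ without intervention. If $P(\mathbf e)=\sum_{\mathbf u:\mathbf E(\mathbf u)=\mathbf e}P(\mathbf u)>0$, Pearl's abduction–action–prediction procedure gives $$P(\mathbf u\mid\mathbf e)=\frac{P(\mathbf e\mid\mathbf u)P(\mathbf u)}{P(\mathbf e)},\qquad P(\mathbf Y_{\mathbf x}=\mathbf y\mid\mathbf e)=\sum_{\mathbf u:\mathbf Y_{\mathbf x}(\mathbf u)=\mathbf y}P(\mathbf u\mid\mathbf e).$$ **Quantum side.** A quantum structural causal model (QSM) consists of endogenous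 nodes $A_i$ and exogenous nodes $\Lambda_i$ with finite-dimensional input and output spaces, a sink $S$, a unitary $W:\bigotimes_i\mathcal H_{A_i^{\rm out}}\otimes\mathcal H_{\Lambda_i^{\rm out}}\to\bigotimes_i\mathcal H_{A_i^{\rm in}}\otimes\mathcal H_{S^{\rm in}}$ defining a normalised process and such that $\Lambda_j$ does not influence $A_i$ for $j\ne i$, and discard-and-prepare instruments that prepare states $\rho_i^{\lambda_i}$ at $\Lambda_i$ with probability $P(\lambda_i)$, independently for different $i$. If a joint distribution $P(\boldsymbol\lambda)$ that need not factorise is allowed, we speak of a QSM with correlated prior. Put $$\sigma^{\boldsymbol\lambda}=\mathrm{tr}_{S^{\rm in}\boldsymbol\Lambda}[\rho^W\,\widetilde\tau^{\boldsymbol\lambda}]/P(\boldsymbol\lambda),\qquad \widetilde\tau^{\boldsymbol\lambda}=P(\boldsymbol\lambda)\bigotimes_i(\rho_i^{\lambda_i})^T\otimes\tfrac{1}{\dim\mathcal H_{\Lambda_i^{\rm in}}}\mathbb I,\qquad \sigma=\sum_{\boldsymbol\lambda}\mathrm{tr}_{S^{\rm in}\boldsymbol\Lambda}[\rho^W\widetilde\tau^{\boldsymbol\lambda}],$$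 where $\rho^W$ is the Choi–Jamiołkowski operator of $W$. For instruments $\mathbf z$ at the endogenous nodes and outcomes $\mathbf a$ at some of them (outcomes elsewhere being summed over) put $P_{\mathbf z}^{\boldsymbol\lambda}(\mathbf a)=\mathrm{tr}[\sigma^{\boldsymbol\lambda}\tau^{\mathbf a|\mathbf z}]$, $P_{\mathbf z}(\mathbf a)=\mathrm{tr}[\sigma\tau^{\mathbf a|\mathbf z}]$, and $$P_{\mathbf z}(\boldsymbol\lambda\mid\mathbf a)=\frac{P_{\mathbf z}^{\boldsymbol\lambda}(\mathbf a)P(\boldsymbol\lambda)}{P_{\mathbf z}(\mathbf a)},\qquad P^{\mathbf a|\mathbf z}_{\mathbf b'|\mathbf z'}(\mathbf c')=\sum_{\boldsymbol\lambda}P_{\mathbf z}(\boldsymbol\lambda\mid\mathbf a)\,\frac{P^{\boldsymbol\lambda}_{\mathbf z'}(\mathbf c',\mathbf b')}{P^{\boldsymbol\lambda}_{\mathbf z'}(\mathbf b')},$$ the last being the symbol $*$ if $P^{\boldsymbol\lambda}_{\mathbf z'}(\mathbf b')=0$ for some $\boldsymbol\lambda$ with $P_{\mathbf z}(\boldsymbol\lambda\mid\mathbf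 a)\neq0$. **Quantum extension.** A quantum extension $Q$ of $\langle M,P(\mathbf u)\rangle$ is built from - injective encodings of the values of each $V_i$ and $U_i$ as bit strings; - finite sets $T_i,S_i$ and bijections $f'_i:(t_i,u_i,pa_i)\mapsto(v_i,s_i)$ on the encoded values; - a distribution $P(\mathbf t,\mathbf u)$ whose marginal is $P(\mathbf u)$ (extended by $0$ to bit strings that encode nothing), such that the first component of $f'_i(t_i,u_i,pa_i)$ is $f_i(u_i,pa_i)$ whenever $P(\mathbf t,\mathbf u)\neq0$ and $pa_i$ consists of encoded values. Its unitary $W$ permutes the computational basis: at each $i$ it applies $f'_i$ to $(t_i,u_i)$ and to the registers which the parent nodes hold for $i$, and then copies $v_i$ by CNOT gates onto one ancilla for each child of $i$. These copies form the node of $i$, and the original register goes to the sink. The node of a childless $i$ is the register $v_i$ itself, whose output goes to the sink. The exogenous outcomes are $\boldsymbol\lambda=(\mathbf t,\mathbf u)$ with probability $P(\mathbf t,\mathbf u)$, upon which $|t_i,u_i\rangle$ is prepared and the copy ancillae are set to $|0\rangle$. **Corollary.** Every PSM has a quantum extension; if $P(\mathbf u)=\prod_iP(u_i)$, it has one that is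 a QSM. Every quantum extension $Q$ of a PSM is a QSM with correlated prior. Moreover, let $P(\mathbf e)>0$, let $\mathbf z$ be the projective measurements in the computational bases at all nodes, and identify a value $v$ of $V_i$ with the outcome $|v,\dots,v\rangle$. Then: 1. Bayesian updating in $Q$ commutes with discarding the ancillae: $\sum_{\mathbf t}P_{\mathbf z}(\mathbf t,\mathbf u\mid\mathbf e)=P(\mathbf u\mid\mathbf e)$ for all $\mathbf u$. 2. For all disjoint $\mathbf X,\mathbf Y$ and all values $\mathbf x,\mathbf y$, let $\mathbf z'$ consist of the do-interventions $\tau^{\mathrm{do}(|x_i,\dots,x_i\rangle\langle x_i,\dots,x_i|)}$ (discard the input, prepare this state) at the nodes in $\mathbf X$ and the same projective measurements at all other nodes. Then the do-interventional counterfactual in $Q$ is different from $*$, and $$P^{\mathbf e|\mathbf z}_{\mathbf x|\mathbf z'}(\mathbf y)=P(\mathbf Y_{\mathbf x}=\mathbf y\mid\mathbf e).$$ -/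

import Mathlib

open scoped Kronecker ComplexOrder

noncomputable section

/-! ## Classical structural causal models -/

/-- A finite structural causal model with endogenous variables `V i`, exogenous variables `U i`,
parent sets `Pa i` forming a directed acyclic graph, and structural functions
`v i = f i (u i) (pa i)`. -/
structure CSM (I : Type) where
  U : I → Type
  V : I → Type
  [fintypeU : ∀ i, Fintype (U i)]
  [fintypeV : ∀ i, Fintype (V i)]
  [decU : ∀ i, DecidableEq (U i)]
  [decV : ∀ i, DecidableEq (V i)]
  Pa : I → Finset I
  acyclic : ∀ i, ¬ Relation.TransGen (fun j k => j ∈ Pa k) i i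
  f : ∀ i, U i → (∀ j : {j // j ∈ Pa i}, V j) → V i

attribute [instance] CSM.fintypeU CSM.fintypeV CSM.decU CSM.decV

namespace CSM

variable {I : Type} [Fintype I] [DecidableEq I]

/-- `v` solves the equations of the submodel `M_x` obtained by the intervention `do(X = x)`,
in the situation `u`. Only the values of `x` on `X` matter. -/
def IsSolution (M : CSM I) (X : Finset I) (x : ∀ i, M.V i) (u : ∀ i, M.U i)
    (v : ∀ i, M.V i) : Prop :=
  ∀ i, v i = if i ∈ X then x i else M.f i (u i) (fun j => v j)

/-- The submodel has exactly one solution in every situation, so potential responses exist. -/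
theorem existsUnique_isSolution (M : CSM I) (X : Finset I) (x : ∀ i, M.V i) (u : ∀ i, M.U i) :
    ∃! v, M.IsSolution X x u v := by
  have wf : WellFounded (fun j k => j ∈ M.Pa k) := by
    have : Std.Irrefl (Relation.TransGen (fun j k => j ∈ M.Pa k)) := ⟨M.acyclic⟩
    have h := Finite.wellFounded_of_trans_of_irrefl
      (Relation.TransGen (fun j k => j ∈ M.Pa k))
    exact Subrelation.wf (fun h => Relation.TransGen.single h) h
  let F : ∀ i, (∀ j, j ∈ M.Pa i → M.V j) → M.V i :=
    fun i g => if i ∈ X then x i else M.f i (u i) (fun j => g j.1 j.2)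
  refine ⟨wf.fix F, fun i => wf.fix_eq F i, fun v hv => ?_⟩
  funext i
  induction i using wf.induction with
  | _ i ih =>
    rw [hv i, wf.fix_eq F i]
    simp only [F]
    congr 2
    funext j
    exact ih j.1 j.2

/-- The counterfactual statement `Y_x(u) = y`: the solution of the submodel `M_x` in the
situation `u` takes the values `y` on `Y`. -/
def Holds (M : CSM I) (X : Finset I) (x : ∀ i, M.V i) (Y : Finset I) (y : ∀ i, M.V i)
    (u : ∀ i, M.U i) : Prop :=
  ∃ v, M.IsSolution X x u v ∧ ∀ i ∈ Y, v i = y i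

/-- The observation `E(u) = e` in the model without intervention. -/
def Observes (M : CSM I) (E : Finset I) (e : ∀ i, M.V i) (u : ∀ i, M.U i) : Prop :=
  M.Holds ∅ e E e u

end CSM

/-- A probabilistic structural causal model: a structural causal model with a probability
distribution over the joint values of the exogenous variables. -/
structure PSM (I : Type) [Fintype I] [DecidableEq I] extends CSM I where
  P : (∀ i, U i) → ℝ
  P_nonneg : ∀ u, 0 ≤ P u
  P_sum : ∑ u, P u = 1

namespace PSM

variable {I : Type} [Fintype I] [DecidableEq I]

/-- The exogenous variables are independent: `P(u) = ∏ᵢ P(uᵢ)`. -/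
def Independent (M : PSM I) : Prop :=
  ∃ p : ∀ i, M.U i → ℝ, (∀ i u, 0 ≤ p i u) ∧ (∀ i, ∑ u, p i u = 1) ∧
    ∀ u, M.P u = ∏ i, p i (u i)

open scoped Classical in
/-- `P(e) = ∑_{u | E(u) = e} P(u)`. -/
def evidenceProb (M : PSM I) (E : Finset I) (e : ∀ i, M.V i) : ℝ :=
  ∑ u with M.Observes E e u, M.P u

open scoped Classical in
/-- Abduction: `P(u | e) = P(e | u) P(u) / P(e)`, where `P(e | u)` is `1` if `E(u) = e` and `0`
otherwise. -/
def posterior (M : PSM I) (E : Finset I) (e : ∀ i, M.V i) (u : ∀ i, M.U i) : ℝ :=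
  (if M.Observes E e u then 1 else 0) * M.P u / M.evidenceProb E e

open scoped Classical in
/-- Abduction, action and prediction: `P(Y_x = y | e) = ∑_{u | Y_x(u) = y} P(u | e)`. -/
def counterfactual (M : PSM I) (E : Finset I) (e : ∀ i, M.V i) (X : Finset I) (x : ∀ i, M.V i)
    (Y : Finset I) (y : ∀ i, M.V i) : ℝ :=
  ∑ u with M.Holds X x Y y u, M.posterior E e u

end PSM

/-! ## Operators, channels and instruments in the Choi–Jamiołkowski representation -/

section Operators

variable {A B C D : Type} [Fintype A] [Fintype B] [Fintype C] [Fintype D]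
  [DecidableEq A] [DecidableEq B] [DecidableEq C] [DecidableEq D]

/-- Density matrices. -/
def IsState (ρ : Matrix A A ℂ) : Prop := ρ.PosSemidef ∧ ρ.trace = 1

/-- `τ` on `H_out ⊗ H_in` represents a channel `L(H_in) → L(H_out)`: it is positive and
`tr_out τ = 1`. -/
def IsChannelOp (τ : Matrix (B × A) (B × A) ℂ) : Prop :=
  τ.PosSemidef ∧ ∀ a a', ∑ b, τ (b, a) (b, a') = (1 : Matrix A A ℂ) a a'

/-- A matrix representing a unitary map between Hilbert spaces with bases `A` and `B`. -/
def IsUnitaryMap (W : Matrix B A ℂ) : Prop := W.conjTranspose * W = 1 ∧ W * W.conjTranspose = 1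

/-- The operator `∑ᵢⱼ W|i⟩⟨j|W† ⊗ |i⟩⟨j|` of the map `X ↦ W X W†`. -/
def choi (W : Matrix B A ℂ) : Matrix (B × A) (B × A) ℂ :=
  fun p q => W p.1 p.2 * star (W q.1 q.2)

theorem choi_apply (W : Matrix B A ℂ) (b b' : B) (a a' : A) :
    choi W (b, a) (b', a') = (W * Matrix.single a a' (1 : ℂ) * W.conjTranspose) b b' := by
  simp [choi, Matrix.mul_apply, Matrix.single_apply, ite_and]

/-- System `A` does not influence system `D` under `W : H_A ⊗ H_B → H_C ⊗ H_D`: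
`tr_C ρ^W_{CD|AB} = ρ_{D|B} ⊗ 1_A` for a channel `L(H_B) → L(H_D)`. -/
def NoInfluence (W : Matrix (C × D) (A × B) ℂ) : Prop :=
  ∃ R : Matrix (D × B) (D × B) ℂ, IsChannelOp R ∧
    ∀ d d' a a' b b', ∑ c, choi W ((c, d), (a, b)) ((c, d'), (a', b')) =
      R (d, b) (d', b') * (1 : Matrix A A ℂ) a a'

/-- A quantum instrument with outcomes in `O` at a node with input basis `A` and output basis
`B`, represented by positive operators on `H_out ⊗ H_in` whose sum represents a channel. -/
structure Instrument (A B O : Type) [Fintype A] [Fintype B] [Fintype O] [DecidableEq A] where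
  τ : O → Matrix (B × A) (B × A) ℂ
  pos : ∀ o, (τ o).PosSemidef
  channel : IsChannelOp (∑ o, τ o)

theorem posSemidef_single_one (w : A) : (Matrix.single w w (1 : ℂ)).PosSemidef := by
  rw [← Matrix.diagonal_single]
  refine Matrix.PosSemidef.diagonal (fun i => ?_)
  by_cases hi : i = w <;> simp [Pi.single_apply, hi]

/-- The projective measurement in the preferred basis, `τ^w = (|w⟩⟨w|_out)ᵀ ⊗ |w⟩⟨w|_in`. -/
def Instrument.measure (A : Type) [Fintype A] [DecidableEq A] : Instrument A A A where
  τ w := (Matrix.single w w (1 : ℂ)).transpose ⊗ₖ Matrix.single w w (1 : ℂ)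
  pos w := by
    have h := posSemidef_single_one w
    exact h.transpose.kronecker h
  channel := by
    have h := posSemidef_single_one (A := A)
    refine ⟨Matrix.posSemidef_sum _ (fun w _ => (h w).transpose.kronecker (h w)), ?_⟩
    intro a a'
    simp only [Matrix.sum_apply, Matrix.kroneckerMap_apply, Matrix.transpose_apply,
      Matrix.single_apply, Matrix.one_apply]
    by_cases haa : a = a'
    · subst haa
      simp
    · simp only [haa, if_false]
      refine Finset.sum_eq_zero fun b _ => Finset.sum_eq_zero fun w _ => ?_
      by_cases hw : w = a
      · subst hw; simp [haa]
      · simp [hw]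

/-- The do-intervention that discards the input and prepares the basis state `x`:
`τ^{do(|x⟩⟨x|)} = (|x⟩⟨x|_out)ᵀ ⊗ 1_in`. Its only possible outcome is labelled `x`; the
operators of all other labels vanish. -/
def Instrument.doBasis {A : Type} [Fintype A] [DecidableEq A] (x : A) : Instrument A A A where
  τ w := if w = x then (Matrix.single x x (1 : ℂ)).transpose ⊗ₖ (1 : Matrix A A ℂ) else 0
  pos w := by
    have h := posSemidef_single_one x
    split_ifs
    · exact h.transpose.kronecker Matrix.PosSemidef.one
    · exact Matrix.PosSemidef.zero
  channel := by
    have h := posSemidef_single_one x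
    rw [Finset.sum_ite_eq' Finset.univ x]
    simp only [Finset.mem_univ, if_true]
    refine ⟨h.transpose.kronecker Matrix.PosSemidef.one, fun a a' => ?_⟩
    simp [Matrix.single_apply]

end Operators

/-! ## Quantum structural causal models -/

/-- The data of a quantum structural causal model. Node `i` has input and output basis `In i`,
`Out i`; the exogenous node of `i` has input and output basis `Lin i`, `Lout i`; the sink has
input basis `S`. `W` maps `⊗ Out i ⊗ Lout i` to `⊗ In i ⊗ S`. The discard-and-prepare instrument
of the `i`-th exogenous node prepares `state i l` upon outcome `l : Lam i`, and `prior` is the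
joint probability of the outcomes. -/
structure QSMData (I : Type) where
  In : I → Type
  Out : I → Type
  Lin : I → Type
  Lout : I → Type
  Lam : I → Type
  S : Type
  [fintypeIn : ∀ i, Fintype (In i)]
  [fintypeOut : ∀ i, Fintype (Out i)]
  [fintypeLin : ∀ i, Fintype (Lin i)]
  [fintypeLout : ∀ i, Fintype (Lout i)]
  [fintypeLam : ∀ i, Fintype (Lam i)]
  [fintypeS : Fintype S]
  [decIn : ∀ i, DecidableEq (In i)]
  [decOut : ∀ i, DecidableEq (Out i)]
  [decLin : ∀ i, DecidableEq (Lin i)]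
  [decLout : ∀ i, DecidableEq (Lout i)]
  [decLam : ∀ i, DecidableEq (Lam i)]
  [decS : DecidableEq S]
  W : Matrix ((∀ i, In i) × S) ((∀ i, Out i) × (∀ i, Lout i)) ℂ
  state : ∀ i, Lam i → Matrix (Lout i) (Lout i) ℂ
  prior : (∀ i, Lam i) → ℝ

attribute [instance] QSMData.fintypeIn QSMData.fintypeOut QSMData.fintypeLin QSMData.fintypeLout
  QSMData.fintypeLam QSMData.fintypeS QSMData.decIn QSMData.decOut QSMData.decLin
  QSMData.decLout QSMData.decLam QSMData.decS

namespace QSMData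

variable {I : Type} [Fintype I] [DecidableEq I]

/-- Index set of the operators on the endogenous nodes, `⊗ᵢ H_{Aᵢ^in} ⊗ H_{Aᵢ^out}`. -/
abbrev Nodes (Q : QSMData I) : Type := (∀ i, Q.In i) × (∀ i, Q.Out i)

/-- Index set of the operators on the exogenous nodes, `⊗ᵢ H_{Λᵢ^out} ⊗ H_{Λᵢ^in}`. -/
abbrev ExoNodes (Q : QSMData I) : Type := ∀ i, Q.Lout i × Q.Lin i

/-- `ρᵀ_{Λ^out} ⊗ (1 / dim H_{Λ^in}) 1_{Λ^in}`. -/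
def prepOp (Q : QSMData I) (i : I) (ρ : Matrix (Q.Lout i) (Q.Lout i) ℂ) :
    Matrix (Q.Lout i × Q.Lin i) (Q.Lout i × Q.Lin i) ℂ :=
  ρ.transpose ⊗ₖ ((Fintype.card (Q.Lin i) : ℂ)⁻¹ • (1 : Matrix (Q.Lin i) (Q.Lin i) ℂ))

/-- Tensor product of operators at the exogenous nodes. -/
def exoTensor (Q : QSMData I)
    (T : ∀ i, Matrix (Q.Lout i × Q.Lin i) (Q.Lout i × Q.Lin i) ℂ) :
    Matrix Q.ExoNodes Q.ExoNodes ℂ :=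
  fun p q => ∏ i, T i (p i) (q i)

/-- Tensor product of operators at the endogenous nodes. -/
def nodeTensor (Q : QSMData I)
    (τ : ∀ i, Matrix (Q.Out i × Q.In i) (Q.Out i × Q.In i) ℂ) :
    Matrix Q.Nodes Q.Nodes ℂ :=
  fun p q => ∏ i, τ i (p.2 i, p.1 i) (q.2 i, q.1 i)

/-- `tr_{S^in Λ}[ρ^W (1 ⊗ T)]`, an operator on the endogenous nodes, for an operator `T` on the
exogenous nodes (`ρ^W` is padded with the identity on `Λ^in`). -/
def reduce (Q : QSMData I) (T : Matrix Q.ExoNodes Q.ExoNodes ℂ) : Matrix Q.Nodes Q.Nodes ℂ :=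
  fun p q => ∑ s, ∑ l : ∀ i, Q.Lout i, ∑ l' : ∀ i, Q.Lout i, ∑ m : ∀ i, Q.Lin i,
    choi Q.W ((p.1, s), (p.2, l)) ((q.1, s), (q.2, l')) *
      T (fun i => (l' i, m i)) (fun i => (l i, m i))

/-- The operator of the joint outcome `l` of the exogenous instruments, with total weight
`prior l`. -/
def exoOp (Q : QSMData I) (l : ∀ i, Q.Lam i) : Matrix Q.ExoNodes Q.ExoNodes ℂ :=
  (Q.prior l : ℂ) • Q.exoTensor (fun i => Q.prepOp i (Q.state i (l i)))

/-- If the prior is a product, the joint operator is the tensor product of the operators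
`p(λᵢ) ρᵀ ⊗ 1 / dim` of the local discard-and-prepare instruments. -/
theorem exoOp_eq_of_prod (Q : QSMData I) (p : ∀ i, Q.Lam i → ℝ)
    (h : ∀ l, Q.prior l = ∏ i, p i (l i)) (l : ∀ i, Q.Lam i) :
    Q.exoOp l = Q.exoTensor (fun i => (p i (l i) : ℂ) • Q.prepOp i (Q.state i (l i))) := by
  funext a b
  simp [exoOp, exoTensor, h, Finset.prod_mul_distrib]

/-- The splitting of the rows of `W` into the input of node `i` and everything else. -/
def rowSplit (Q : QSMData I) (i : I) :
    ((∀ k, Q.In k) × Q.S) ≃ ((∀ k : {k // k ≠ i}, Q.In k) × Q.S) × Q.In i :=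
  ((Equiv.piSplitAt i Q.In).prodCongr (Equiv.refl Q.S)).trans
    ⟨fun p => ((p.1.2, p.2), p.1.1), fun q => ((q.2, q.1.1), q.1.2), fun _ => rfl, fun _ => rfl⟩

/-- The splitting of the columns of `W` into the output of the exogenous node `j` and everything
else. -/
def colSplit (Q : QSMData I) (j : I) :
    ((∀ k, Q.Out k) × (∀ k, Q.Lout k)) ≃
      Q.Lout j × ((∀ k, Q.Out k) × (∀ k : {k // k ≠ j}, Q.Lout k)) :=
  ((Equiv.refl (∀ k, Q.Out k)).prodCongr (Equiv.piSplitAt j Q.Lout)).trans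
    ⟨fun p => (p.2.1, (p.1, p.2.2)), fun q => (q.2.1, (q.1, q.2.2)), fun _ => rfl, fun _ => rfl⟩

/-- A quantum structural causal model whose exogenous outcomes are distributed according to an
arbitrary, possibly correlated, joint prior. -/
structure IsCorrelatedQSM (Q : QSMData I) : Prop where
  nonempty_exoIn : ∀ i, Nonempty (Q.Lin i)
  unitary : IsUnitaryMap Q.W
  /-- normalisation of the process for all channels at the endogenous nodes and all states
  prepared at the exogenous nodes -/
  normalised : ∀ (τ : ∀ i, Matrix (Q.Out i × Q.In i) (Q.Out i × Q.In i) ℂ)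
    (ρ : ∀ i, Matrix (Q.Lout i) (Q.Lout i) ℂ),
    (∀ i, IsChannelOp (τ i)) → (∀ i, IsState (ρ i)) →
    (Q.reduce (Q.exoTensor fun i => Q.prepOp i (ρ i)) * Q.nodeTensor τ).trace = 1
  /-- `Λⱼ` does not influence `Aᵢ` for `j ≠ i` -/
  noInfluence : ∀ i j, j ≠ i → NoInfluence (Q.W.reindex (Q.rowSplit i) (Q.colSplit j))
  state_isState : ∀ i l, IsState (Q.state i l)
  prior_nonneg : ∀ l, 0 ≤ Q.prior l
  prior_sum : ∑ l, Q.prior l = 1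

/-- A quantum structural causal model: every exogenous node carries its own discard-and-prepare
instrument, so that the outcomes of different exogenous nodes are independent. -/
def IsQSM (Q : QSMData I) : Prop :=
  Q.IsCorrelatedQSM ∧ ∃ p : ∀ i, Q.Lam i → ℝ, (∀ i l, 0 ≤ p i l) ∧ (∀ i, ∑ l, p i l = 1) ∧
    ∀ l, Q.prior l = ∏ i, p i (l i)

/-- The process operator `σ_A = tr_{S^in Λ}[ρ^W (τ̃^{ρ₁} ⊗ ⋯ ⊗ τ̃^{ρₙ})]`. -/
def sigma (Q : QSMData I) : Matrix Q.Nodes Q.Nodes ℂ := Q.reduce (∑ l, Q.exoOp l)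

/-- The conditional process operator `σ_A^λ = tr_{S^in Λ}[ρ^W τ̃^λ] / P(λ)`. -/
def sigmaCond (Q : QSMData I) (l : ∀ i, Q.Lam i) : Matrix Q.Nodes Q.Nodes ℂ :=
  (Q.prior l : ℂ)⁻¹ • Q.reduce (Q.exoOp l)

section Queries

variable {O : I → Type} [∀ i, Fintype (O i)]

/-- The operators of the event that the instruments `z` yield the outcomes `o` at the nodes
in `B`, the outcomes at all other nodes being ignored. -/
def eventOp (Q : QSMData I) (z : ∀ i, Instrument (Q.In i) (Q.Out i) (O i)) (B : Finset I)
    (o : ∀ i, O i) (i : I) : Matrix (Q.Out i × Q.In i) (Q.Out i × Q.In i) ℂ :=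
  if i ∈ B then (z i).τ (o i) else ∑ w, (z i).τ w

/-- `P_z^λ(o_B) = tr[σ^λ τ^{o|z}]`. -/
def condProb (Q : QSMData I) (z : ∀ i, Instrument (Q.In i) (Q.Out i) (O i)) (B : Finset I)
    (o : ∀ i, O i) (l : ∀ i, Q.Lam i) : ℂ :=
  (Q.sigmaCond l * Q.nodeTensor (Q.eventOp z B o)).trace

/-- `P_z(o_B) = tr[σ τ^{o|z}]`. -/
def prob (Q : QSMData I) (z : ∀ i, Instrument (Q.In i) (Q.Out i) (O i)) (B : Finset I)
    (o : ∀ i, O i) : ℂ :=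
  (Q.sigma * Q.nodeTensor (Q.eventOp z B o)).trace

/-- Abduction: the Bayesian update `P_z(λ | a) = P_z(a | λ) P(λ) / P_z(a)` on the outcomes `a`
obtained at the nodes in `E`. -/
def posterior (Q : QSMData I) (z : ∀ i, Instrument (Q.In i) (Q.Out i) (O i)) (E : Finset I)
    (a : ∀ i, O i) (l : ∀ i, Q.Lam i) : ℂ :=
  Q.condProb z E a l * (Q.prior l : ℂ) / Q.prob z E a

open scoped Classical in
/-- The counterfactual probability `P^λ_{z'}(c' | b')` of the outcomes `c'` at the nodes in `C`
given the outcomes `b'` at the nodes in `B`; the value `none` stands for the symbol `*` of a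
counterpossible. -/
def cfProb (Q : QSMData I) (z' : ∀ i, Instrument (Q.In i) (Q.Out i) (O i)) (B : Finset I)
    (b : ∀ i, O i) (C : Finset I) (c : ∀ i, O i) (l : ∀ i, Q.Lam i) : Option ℂ :=
  if Q.condProb z' B b l = 0 then none
  else some (Q.condProb z' (B ∪ C) (fun i => if i ∈ B then b i else c i) l /
    Q.condProb z' B b l)

open scoped Classical in
/-- The quantum counterfactual query: the expected counterfactual probability of `c'` at `C`, had
the instruments `z'` been implemented and the outcomes `b'` been obtained at `B`, given that the
instruments `z` were implemented and the outcomes `a` obtained at `E`. It is `none` (that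
is, `*`) if the antecedent is impossible for some exogenous outcomes of nonzero posterior. -/
def query (Q : QSMData I) (z : ∀ i, Instrument (Q.In i) (Q.Out i) (O i)) (E : Finset I)
    (a : ∀ i, O i) (z' : ∀ i, Instrument (Q.In i) (Q.Out i) (O i)) (B : Finset I)
    (b : ∀ i, O i) (C : Finset I) (c : ∀ i, O i) : Option ℂ :=
  if ∃ l, Q.posterior z E a l ≠ 0 ∧ Q.cfProb z' B b C c l = none then none
  else some (∑ l, Q.posterior z E a l * (Q.cfProb z' B b C c l).getD 0)

end Queries

end QSMData

/-! ## The quantum extension of a probabilistic structural causal model -/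

/-- Strings of `n` bits; addition is the bitwise exclusive or. -/
abbrev Bits (n : ℕ) : Type := Fin n → ZMod 2

/-- The choices made in extending `⟨M, P(u)⟩` to a quantum structural causal model: binary
encodings of the variables, a reversible (bijective) extension of the structural functions by
ancillae `T i` and sinks `S i`, and a prior on the exogenous values and ancillae. -/
structure QuantumExtension {I : Type} [Fintype I] [DecidableEq I] (M : PSM I) where
  nV : I → ℕ
  nU : I → ℕ
  encV : ∀ i, M.V i ↪ Bits (nV i)
  encU : ∀ i, M.U i ↪ Bits (nU i)
  T : I → Type
  S : I → Type
  [fintypeT : ∀ i, Fintype (T i)]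
  [fintypeS : ∀ i, Fintype (S i)]
  [decT : ∀ i, DecidableEq (T i)]
  [decS : ∀ i, DecidableEq (S i)]
  /-- the reversible structural functions `(tᵢ, uᵢ, paᵢ) ↦ (vᵢ, sᵢ)` -/
  fRev : ∀ i, (T i × Bits (nU i)) × (∀ j : {j // j ∈ M.Pa i}, Bits (nV j)) ≃ Bits (nV i) × S i
  prior : (∀ i, T i × Bits (nU i)) → ℝ
  prior_nonneg : ∀ l, 0 ≤ prior l
  /-- discarding the ancillae gives the encoded distribution `P(u)`, extended by zero -/
  prior_marginal : ∀ w : ∀ i, Bits (nU i),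
    ∑ t : ∀ i, T i, prior (fun i => (t i, w i)) =
      ∑ u : ∀ i, M.U i, if (fun i => encU i (u i)) = w then M.P u else 0
  /-- the first component of the reversible function is the encoded structural function, on all
  values of the ancillae and exogenous variables that the prior admits -/
  fRev_lifts : ∀ l, prior l ≠ 0 → ∀ i (u : M.U i), encU i u = (l i).2 →
    ∀ p : ∀ j : {j // j ∈ M.Pa i}, M.V j,
      (fRev i (l i, fun j => encV j (p j))).1 = encV i (M.f i u p)

attribute [instance] QuantumExtension.fintypeT QuantumExtension.fintypeS
  QuantumExtension.decT QuantumExtension.decS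

namespace QuantumExtension

variable {I : Type} [Fintype I] [DecidableEq I] {M : PSM I}

/-- The registers of the quantum node of `i`: one copy of the variable for each child of `i`; a
childless node has a single register, the variable itself. -/
abbrev Reg (M : PSM I) (i : I) : Type := {j // i ∈ M.Pa j} ⊕ {_u : Unit // ∀ j, i ∉ M.Pa j}

/-- Basis of the input and of the output space of the quantum node of `i`. -/
abbrev NodeBasis (Q : QuantumExtension M) (i : I) : Type := Reg M i → Bits (Q.nV i)

/-- Basis of the exogenous node of `i`: the ancilla `T i`, the exogenous variable, and one copy
ancilla for each child of `i`. -/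
abbrev ExoBasis (Q : QuantumExtension M) (i : I) : Type :=
  (Q.T i × Bits (Q.nU i)) × ({j // i ∈ M.Pa j} → Bits (Q.nV i))

/-- Basis of the sink: for each `i` the output `S i` of the reversible function, and one discarded
register (the variable itself after it was copied to the children of `i`, or, for a childless
node, the output of that node). -/
abbrev SinkBasis (Q : QuantumExtension M) : Type := ∀ i, Q.S i × Bits (Q.nV i)

/-- The action of the unitary on basis states. At each `i` the reversible function is applied to
the exogenous value and to the registers that the parents of `i` hold for `i`; then the value is
copied by CNOT gates, `(x, v) ↦ (x + v, v)`, onto the copy ancilla of every child. -/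
def circuit (Q : QuantumExtension M) (p : (∀ i, Q.NodeBasis i) × (∀ i, Q.ExoBasis i)) :
    (∀ i, Q.NodeBasis i) × Q.SinkBasis :=
  let out : ∀ i, Bits (Q.nV i) × Q.S i :=
    fun i => Q.fRev i ((p.2 i).1, fun j => p.1 j.1 (Sum.inl ⟨i, j.2⟩))
  (fun i => Sum.elim (fun j => (p.2 i).2 j + (out i).1) (fun _ => (out i).1),
   fun i => ((out i).2,
     if h : ∀ j, i ∉ M.Pa j then p.1 i (Sum.inr ⟨(), h⟩) else (out i).1))

/-- The quantum extension. The outcomes of the exogenous instrument of `i` are the values of the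
ancilla `T i` and of the encoded exogenous variable; upon outcome `l` it prepares the basis state
`|l⟩⟨l| ⊗ |0⟩⟨0|` with all copy ancillae initialised to zero. -/
def toQSM (Q : QuantumExtension M) : QSMData I where
  In := Q.NodeBasis
  Out := Q.NodeBasis
  Lin := Q.ExoBasis
  Lout := Q.ExoBasis
  Lam i := Q.T i × Bits (Q.nU i)
  S := Q.SinkBasis
  W := fun b a => if Q.circuit a = b then 1 else 0
  state _ l := Matrix.single (l, 0) (l, 0) 1
  prior := Q.prior

/-- The copied basis state `|v, …, v⟩` of the node of `i` that encodes the value `v`. -/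
def ket (Q : QuantumExtension M) (i : I) (v : M.V i) : Q.NodeBasis i := fun _ => Q.encV i v

/-- Observation of all endogenous variables, in the preferred bases. -/
def observe (Q : QuantumExtension M) (i : I) :
    Instrument (Q.toQSM.In i) (Q.toQSM.Out i) (Q.NodeBasis i) :=
  Instrument.measure (Q.NodeBasis i)

/-- The instruments with the do-intervention `do(X = x)` at the nodes in `X`, all others being
observed. -/
def doInstr (Q : QuantumExtension M) (X : Finset I) (x : ∀ i, M.V i) (i : I) :
    Instrument (Q.toQSM.In i) (Q.toQSM.Out i) (Q.NodeBasis i) :=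
  if i ∈ X then Instrument.doBasis (Q.ket i (x i)) else Instrument.measure (Q.NodeBasis i)

/-- The posterior `P_z(t, u | e)` of the exogenous outcomes of the quantum extension, given that
all nodes are observed and the values `e` are found at `E`. -/
def posterior (Q : QuantumExtension M) (E : Finset I) (e : ∀ i, M.V i)
    (l : ∀ i, Q.T i × Bits (Q.nU i)) : ℂ :=
  Q.toQSM.posterior Q.observe E (fun i => Q.ket i (e i)) l

/-- The do-interventional counterfactual query corresponding to `P(Y_x = y | e)`. -/
def counterfactual (Q : QuantumExtension M) (E : Finset I) (e : ∀ i, M.V i) (X : Finset I)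
    (x : ∀ i, M.V i) (Y : Finset I) (y : ∀ i, M.V i) : Option ℂ :=
  Q.toQSM.query Q.observe E (fun i => Q.ket i (e i))
    (Q.doInstr X x) X (fun i => Q.ket i (x i)) Y (fun i => Q.ket i (y i))

end QuantumExtension

end

/-!
The unitary of a quantum extension permutes the computational basis, so every probability is a sum
over pairs of computational paths that agree in the sink
(`QSMData.trace_reduce_mul_nodeTensor`).

*Every quantum extension is a QSM with correlated prior.* The basic fact is reversibility
(`QuantumExtension.out_and_circuit_eq_iff`): what node `i` receives, together with what the sink
keeps of `i`, determines the exogenous value of `i` and everything its parents sent to it. It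
gives unitarity at once. It also gives the absence of influence of `Λⱼ` on `Aᵢ`, since the partial
trace over the complement of `Aᵢ` then forces both paths to agree on `Λⱼ`
(`noInfluence_basisMap`). Finally it gives normalisation: the nodes are eliminated in reverse
topological order, and if two paths agree on everything that `i` sends, the channel at `i` forces
them to agree on what `i` receives, hence on everything that was sent to `i`
(`sum_prod_eq_one_of_acyclic`, `QSMData.trace_reduce_eq_one_of_acyclic`).

*Counterfactuals.* Exogenous outcomes prepare basis states, and neither projective measurements
nor do-interventions create coherence, so only single paths contribute
(`QSMData.trace_reduce_single`). By acyclicity the only path compatible with `do(X = x)` and an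
exogenous outcome encoding `u` is the encoded solution of the submodel `M_x`; the conditional
probabilities are therefore `0` or `1` and given by the classical potential responses
(`QuantumExtension.condProb_doInstr`). In particular the antecedent of a do-intervention has
probability `1`, so the counterfactual query is not `*`. As these probabilities depend on the
encoded `u` only, averaging over the prior reduces to averaging over `P(u)`
(`QuantumExtension.sum_prior_mul`).

*Existence.* The reversible functions `(t, u, pa) ↦ (t + f(u, pa), (u, pa))`, with all `t` set to
zero, define a quantum extension, whose prior factorises if `P(u)` does
(`PSM.quantumExtension`, `PSM.quantumExtension_isQSM`).
-/

/-! ### Summation along a directed acyclic graph -/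

section Elimination

variable {I : Type} [Fintype I] [DecidableEq I] {K : I → Type} [∀ i, Fintype (K i)]

omit [Fintype I] [DecidableEq I] in
theorem wellFounded_of_acyclic [Finite I] {r : I → I → Prop}
    (h : ∀ i, ¬ Relation.TransGen r i i) : WellFounded r := by
  have : Std.Irrefl (Relation.TransGen r) := ⟨h⟩
  exact Subrelation.wf (fun h => Relation.TransGen.single h)
    (Finite.wellFounded_of_trans_of_irrefl (Relation.TransGen r))

/-- Two functions have the same sum if their sums over the `i`-th coordinate agree. -/
theorem sum_pi_eq_of_sum_update_eq {f g : (∀ i, K i) → ℂ} (i : I) (x₀ : K i)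
    (h : ∀ c : ∀ i, K i, ∑ x, f (Function.update c i x) = ∑ x, g (Function.update c i x)) :
    ∑ c, f c = ∑ c, g c := by
  have key : ∀ f : (∀ i, K i) → ℂ, ∑ c, f c = ∑ r : ∀ j : {j // j ≠ i}, K j, ∑ x,
      f (Function.update ((Equiv.piSplitAt i K).symm (x₀, r)) i x) := by
    intro f
    rw [← (Equiv.piSplitAt i K).symm.sum_comp, Fintype.sum_prod_type_right]
    refine Finset.sum_congr rfl fun r _ => Finset.sum_congr rfl fun x _ => congrArg f ?_
    funext j
    by_cases hj : j = i
    · subst hj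
      simp
    · simp [Equiv.piSplitAt, hj]
  rw [key f, key g]
  exact Finset.sum_congr rfl fun r _ => h _

/-- Summation along a directed acyclic graph. The factor `H i` depends only on the variables of
`i` and of its parents; summing it over the variable of `i`, weighted with the edge factors towards
the children of `i`, leaves the edge factors from the parents of `i`. Eliminating the nodes in
reverse topological order, the whole sum is `1`. -/
theorem sum_prod_eq_one_of_acyclic [∀ i, DecidableEq (K i)] (Pa : I → Finset I)
    (acyclic : ∀ i, ¬ Relation.TransGen (fun j k => j ∈ Pa k) i i)
    (H : ∀ _ : I, (∀ i, K i) → ℂ) (E : ∀ j : I, I → K j → ℂ) (c₀ : ∀ i, K i)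
    (hH : ∀ k i c x, k ≠ i → i ∉ Pa k → H k (Function.update c i x) = H k c)
    (hE : ∀ j k x, j ∉ Pa k → E j k x = 1) (hE₀ : ∀ j k, E j k (c₀ j) = 1)
    (hsum : ∀ i c, ∑ x, H i (Function.update c i x) * ∏ k, E i k x = ∏ j, E j i (c j)) :
    ∑ c, ∏ i, H i c = 1 := by
  have wf : WellFounded (fun j k => k ∈ Pa j) :=
    wellFounded_of_acyclic fun i hi => acyclic i (Relation.transGen_swap.1 hi)
  have irrefl : ∀ i, i ∉ Pa i := fun i hi => acyclic i (Relation.TransGen.single hi)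
  -- Nodes outside `D` are already eliminated: their variables are pinned to `c₀`, and what is left
  -- of them are the edge factors from their parents.
  let F : Finset I → I → (∀ i, K i) → ℂ := fun D k c =>
    if k ∈ D then H k c else (if c k = c₀ k then 1 else 0) * ∏ j, E j k (c j)
  have claim : ∀ D : Finset I, (∀ k ∈ D, Pa k ⊆ D) → ∑ c, ∏ k, F D k c = 1 := by
    intro D
    induction D using Finset.strongInduction with
    | _ D ih =>
      intro hD
      rcases D.eq_empty_or_nonempty with rfl | hne
      · rw [Finset.sum_eq_single c₀]
        · simp [F, hE₀]
        · intro c _ hc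
          obtain ⟨k, hk⟩ := Function.ne_iff.1 hc
          exact Finset.prod_eq_zero (Finset.mem_univ k) (by simp [F, hk])
        · simp
      · obtain ⟨i, hi, hmax⟩ := wf.has_min (D : Set I) hne
        have hi : i ∈ D := hi
        have hmax : ∀ k ∈ D, i ∉ Pa k := fun k hk h => hmax k hk h
        rw [← ih (D.erase i) (Finset.erase_ssubset hi) fun k hk j hj => Finset.mem_erase.2
          ⟨fun h => hmax k (Finset.mem_of_mem_erase hk) (h ▸ hj),
            hD k (Finset.mem_of_mem_erase hk) hj⟩]
        refine sum_pi_eq_of_sum_update_eq i (c₀ i) fun c => ?_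
        have hprod : ∀ (k : I) (x : K i), k ≠ i → ∏ j, E j k (Function.update c i x j) =
            (∏ j, E j k (Function.update c i (c₀ i) j)) * E i k x := by
          intro k x hk
          rw [Fintype.prod_eq_mul_prod_compl i, Fintype.prod_eq_mul_prod_compl i]
          simp only [Function.update_self, hE₀, one_mul]
          rw [mul_comm]
          congr 1
          refine Finset.prod_congr rfl fun j hj => ?_
          have hj : j ≠ i := by simpa using hj
          simp [hj]
        have hF : ∀ (k : I) (x : K i), k ≠ i → F D k (Function.update c i x) =
            F D k (Function.update c i (c₀ i)) * E i k x := by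
          intro k x hk
          by_cases hkD : k ∈ D
          · simp [F, hkD, hH k i _ _ hk (hmax k hkD), hE i k x (hmax k hkD)]
          · simp only [F, hkD, if_false]
            rw [hprod k x hk, Function.update_of_ne hk, Function.update_of_ne hk, mul_assoc]
        have hF' : ∀ (k : I) (c : ∀ i, K i), k ≠ i → F (D.erase i) k c = F D k c := by
          intro k c hk
          simp [F, hk]
        have hEi : ∀ x, ∏ k, E i k x = ∏ k ∈ {i}ᶜ, E i k x := by
          intro x
          rw [Fintype.prod_eq_mul_prod_compl i, hE i i x (irrefl i), one_mul]
        have hpar : ∀ x, ∏ j, E j i (Function.update c i x j) = ∏ j, E j i (c j) := by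
          intro x
          refine Finset.prod_congr rfl fun j _ => ?_
          by_cases hj : j = i
          · subst hj
            rw [hE _ _ _ (irrefl j), hE _ _ _ (irrefl j)]
          · simp [hj]
        have hsplit : ∀ x, ∏ k, F D k (Function.update c i x) =
            (∏ k ∈ {i}ᶜ, F D k (Function.update c i (c₀ i))) *
              (H i (Function.update c i x) * ∏ k, E i k x) := by
          intro x
          rw [Fintype.prod_eq_mul_prod_compl i, hEi, Finset.prod_congr rfl fun k hk =>
            hF k x (by simpa using hk), Finset.prod_mul_distrib]
          simp only [F, hi, if_true]
          ring
        have hsplit' : ∀ x, ∏ k, F (D.erase i) k (Function.update c i x) =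
            (∏ k ∈ {i}ᶜ, F D k (Function.update c i (c₀ i))) *
              ((if x = c₀ i then 1 else 0) * (∏ j, E j i (c j)) * ∏ k, E i k x) := by
          intro x
          rw [Fintype.prod_eq_mul_prod_compl i, hEi, Finset.prod_congr rfl fun k hk =>
            (hF' k _ (by simpa using hk)).trans (hF k x (by simpa using hk)),
            Finset.prod_mul_distrib]
          simp only [F, Finset.notMem_erase, if_false, hpar, Function.update_self]
          ring
        simp only [hsplit, hsplit', ← Finset.mul_sum, hsum]
        congr 1
        simp [ite_mul, hE₀]
  simpa [F] using claim Finset.univ fun k _ => Finset.subset_univ _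

end Elimination

/-! ### Unitary maps that permute basis states -/

section Permutation

variable {A B C D : Type} [Fintype A] [Fintype B] [Fintype C] [Fintype D]
  [DecidableEq A] [DecidableEq B] [DecidableEq C] [DecidableEq D]

open scoped Classical in
/-- The linear map that sends the basis state `|a⟩` to `|w a⟩`. -/
def basisMap (w : A → B) : Matrix B A ℂ := Matrix.of fun b a => if w a = b then 1 else 0

omit [Fintype A] [Fintype B] [DecidableEq A] in
theorem basisMap_apply (w : A → B) (b : B) (a : A) :
    basisMap w b a = if w a = b then 1 else 0 := by
  simp [basisMap]

theorem isUnitaryMap_basisMap (e : A ≃ B) : IsUnitaryMap (basisMap e) := by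
  constructor
  · ext a a'
    simp [Matrix.mul_apply, Matrix.conjTranspose_apply, Matrix.one_apply, basisMap_apply, eq_comm]
  · ext b b'
    simp only [Matrix.mul_apply, Matrix.conjTranspose_apply, Matrix.one_apply, basisMap_apply]
    rw [← e.symm.sum_comp]
    simp [eq_comm]

omit [Fintype A] in
/-- A permutation `w` of basis states under which `A` does not influence `D`: besides `D` being a
function of `B` alone, the complementary output `C` must determine `A`, and whether two inputs
agree on `C` must not depend on their common value on `A`. -/
theorem noInfluence_basisMap [Nonempty A] (w : A × B → C × D) (hw : Function.Injective w)
    (g : B → D) (hg : ∀ a b, (w (a, b)).2 = g b)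
    (hA : ∀ a b a' b', (w (a, b)).1 = (w (a', b')).1 → a = a')
    (hB : ∀ a a' b b', (w (a, b)).1 = (w (a, b')).1 → (w (a', b)).1 = (w (a', b')).1) :
    NoInfluence (basisMap w) := by
  obtain ⟨a₀⟩ := ‹Nonempty A›
  have key : ∀ d d' a a' b b',
      ∑ c, choi (basisMap w) ((c, d), (a, b)) ((c, d'), (a', b')) =
        if (w (a, b)).1 = (w (a', b')).1 ∧ d = g b ∧ d' = g b' then 1 else 0 := by
    intro d d' a a' b b'
    rw [Finset.sum_eq_single (w (a, b)).1]
    · simp only [choi, basisMap_apply, Prod.ext_iff, hg]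
      split_ifs <;> simp_all [eq_comm]
    · intro c _ hc
      have : ¬ w (a, b) = (c, d) := fun h => hc (by rw [h])
      simp [choi, basisMap_apply, this]
    · simp
  let R : Matrix (D × B) (D × B) ℂ := Matrix.of fun p q =>
    if (w (a₀, p.2)).1 = (w (a₀, q.2)).1 ∧ p.1 = g p.2 ∧ q.1 = g q.2 then 1 else 0
  refine ⟨R, ⟨?_, ?_⟩, ?_⟩
  · let N : Matrix C (D × B) ℂ := Matrix.of fun c p => basisMap w (c, p.1) (a₀, p.2)
    have hR : R = N.conjTranspose * N := by
      ext p q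
      simp only [R, N, Matrix.mul_apply, Matrix.conjTranspose_apply, Matrix.of_apply]
      rw [← key p.1 q.1 a₀ a₀ p.2 q.2]
      refine Finset.sum_congr rfl fun c _ => ?_
      simp only [choi, basisMap_apply]
      split_ifs <;> simp
    rw [hR]
    exact Matrix.posSemidef_conjTranspose_mul_self N
  · intro b b'
    rw [Finset.sum_eq_single (g b)]
    · simp only [R, Matrix.one_apply, Matrix.of_apply]
      refine if_congr ⟨fun h => ?_, fun h => ?_⟩ rfl rfl
      · have := hw (Prod.ext (x := w (a₀, b)) (y := w (a₀, b')) h.1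
          (by rw [hg, hg]; exact h.2.2))
        exact (Prod.mk.inj this).2
      · subst h; simp
    · intro d _ hd
      simp [R, hd]
    · simp
  · intro d d' a a' b b'
    rw [key]
    simp only [R, Matrix.one_apply, Matrix.of_apply]
    by_cases h : a = a'
    · subst h
      have : (w (a, b)).1 = (w (a, b')).1 ↔ (w (a₀, b)).1 = (w (a₀, b')).1 :=
        ⟨hB _ _ _ _, hB _ _ _ _⟩
      simp [this]
    · have : ¬ (w (a, b)).1 = (w (a', b')).1 := fun e => h (hA _ _ _ _ e)
      simp [this, h]

end Permutation

/-! ### Processes given by a permutation of basis states -/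

namespace QSMData

variable {I : Type} [Fintype I] [DecidableEq I]

/-- The factors `1 / dim` of the exogenous inputs compensate the trace over these inputs. -/
theorem reduce_exoTensor_prepOp (Q : QSMData I) (hL : ∀ i, Nonempty (Q.Lin i))
    (ρ : ∀ i, Matrix (Q.Lout i) (Q.Lout i) ℂ) (p q : Q.Nodes) :
    Q.reduce (Q.exoTensor fun i => Q.prepOp i (ρ i)) p q =
      ∑ s, ∑ l : ∀ i, Q.Lout i, ∑ l' : ∀ i, Q.Lout i,
        choi Q.W ((p.1, s), (p.2, l)) ((q.1, s), (q.2, l')) * ∏ i, ρ i (l i) (l' i) := by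
  refine Finset.sum_congr rfl fun s _ => Finset.sum_congr rfl fun l _ =>
    Finset.sum_congr rfl fun l' _ => ?_
  rw [← Finset.mul_sum]
  congr 1
  have h : ∀ m : ∀ i, Q.Lin i, Q.exoTensor (fun i => Q.prepOp i (ρ i)) (fun i => (l' i, m i))
      (fun i => (l i, m i)) = (∏ i, ρ i (l i) (l' i)) * ∏ i, (Fintype.card (Q.Lin i) : ℂ)⁻¹ := by
    intro m
    simp [exoTensor, prepOp, Matrix.kroneckerMap_apply, Finset.prod_mul_distrib]
  simp only [h]
  have hc : ∏ i, (Fintype.card (Q.Lin i) : ℂ) ≠ 0 :=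
    Finset.prod_ne_zero_iff.2 fun i _ => by simp
  rw [Finset.sum_const, Finset.card_univ, Fintype.card_pi, nsmul_eq_mul, Finset.prod_inv_distrib]
  push_cast
  field_simp

/-- A reordering of the summations that occur in the generalised Born rule. -/
theorem sum_rotate {A B C D E : Type} [Fintype A] [Fintype B] [Fintype C] [Fintype D] [Fintype E]
    (f : A → A → B → C → D → E → ℂ) :
    ∑ a, ∑ a', ∑ b, ∑ c, ∑ d, ∑ e, f a a' b c d e =
      ∑ d, ∑ b, ∑ e, ∑ a, ∑ a', ∑ c, f a a' b c d e := by
  have h₁ : ∑ x : A × A × B × C × D × E,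
      f x.1 x.2.1 x.2.2.1 x.2.2.2.1 x.2.2.2.2.1 x.2.2.2.2.2 =
      ∑ a, ∑ a', ∑ b, ∑ c, ∑ d, ∑ e, f a a' b c d e := by
    simp only [Fintype.sum_prod_type]
  have h₂ : ∑ x : D × B × E × A × A × C,
      f x.2.2.2.1 x.2.2.2.2.1 x.2.1 x.2.2.2.2.2 x.1 x.2.2.1 =
      ∑ d, ∑ b, ∑ e, ∑ a, ∑ a', ∑ c, f a a' b c d e := by
    simp only [Fintype.sum_prod_type]
  rw [← h₁, ← h₂]
  exact Fintype.sum_equiv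
    ⟨fun x => (x.2.2.2.2.1, x.2.2.1, x.2.2.2.2.2, x.1, x.2.1, x.2.2.2.1),
      fun x => (x.2.2.2.1, x.2.2.2.2.1, x.2.1, x.2.2.2.2.2, x.1, x.2.2.1),
      fun _ => rfl, fun _ => rfl⟩ _ _ fun _ => rfl

/-- The generalised Born rule for a process whose unitary permutes the basis states by `w`: a sum
over pairs of computational paths that agree in the sink. -/
theorem trace_reduce_mul_nodeTensor (Q : QSMData I) (hL : ∀ i, Nonempty (Q.Lin i))
    (w : (∀ i, Q.Out i) × (∀ i, Q.Lout i) → (∀ i, Q.In i) × Q.S)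
    (hW : Q.W = basisMap w)
    (ρ : ∀ i, Matrix (Q.Lout i) (Q.Lout i) ℂ)
    (τ : ∀ i, Matrix (Q.Out i × Q.In i) (Q.Out i × Q.In i) ℂ) :
    (Q.reduce (Q.exoTensor fun i => Q.prepOp i (ρ i)) * Q.nodeTensor τ).trace =
      ∑ a : (∀ i, Q.Out i) × (∀ i, Q.Lout i), ∑ a' : (∀ i, Q.Out i) × (∀ i, Q.Lout i),
        if (w a).2 = (w a').2 then
          ∏ i, (ρ i (a.2 i) (a'.2 i) * τ i (a'.1 i, (w a').1 i) (a.1 i, (w a).1 i))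
        else 0 := by
  have step : ∀ o o' l l', (∑ d, ∑ d', ∑ s,
      choi Q.W ((d, s), (o, l)) ((d', s), (o', l')) * (∏ i, ρ i (l i) (l' i)) *
        ∏ i, τ i (o' i, d' i) (o i, d i)) =
      if (w (o, l)).2 = (w (o', l')).2 then
          ∏ i, (ρ i (l i) (l' i) * τ i (o' i, (w (o', l')).1 i) (o i, (w (o, l)).1 i))
        else 0 := by
    intro o o' l l'
    rw [Finset.sum_eq_single (w (o, l)).1, Finset.sum_eq_single (w (o', l')).1,
      Finset.sum_eq_single (w (o, l)).2]
    · simp only [choi, hW, basisMap_apply, Prod.ext_iff, Finset.prod_mul_distrib]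
      split_ifs <;> simp_all
    · intro s _ hs
      have : ¬ w (o, l) = ((w (o, l)).1, s) := fun h => hs (by rw [h])
      simp [choi, hW, basisMap_apply, this]
    · simp
    · intro d' _ hd
      refine Finset.sum_eq_zero fun s _ => ?_
      have : ¬ w (o', l') = (d', s) := fun h => hd (by rw [h])
      simp [choi, hW, basisMap_apply, this]
    · simp
    · intro d _ hd
      refine Finset.sum_eq_zero fun d' _ => Finset.sum_eq_zero fun s _ => ?_
      have : ¬ w (o, l) = (d, s) := fun h => hd (by rw [h])
      simp [choi, hW, basisMap_apply, this]
    · simp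
  simp only [Fintype.sum_prod_type, ← step]
  simp only [Matrix.trace, Matrix.diag_apply, Matrix.mul_apply, Fintype.sum_prod_type,
    Q.reduce_exoTensor_prepOp hL, nodeTensor, Finset.sum_mul]
  rw [Finset.sum_comm]
  refine Finset.sum_congr rfl fun o _ => ?_
  exact sum_rotate _

/-- The criterion `noInfluence_basisMap`, with the rows and columns of the unitary not split. -/
theorem noInfluence_reindex (Q : QSMData I)
    (w : (∀ i, Q.Out i) × (∀ i, Q.Lout i) → (∀ i, Q.In i) × Q.S) (hW : Q.W = basisMap w)
    (hw : Function.Injective w) (i j : I) (hL : Nonempty (Q.Lout j))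
    (hg : ∀ a b, a.1 = b.1 → (∀ k, k ≠ j → a.2 k = b.2 k) → (w a).1 i = (w b).1 i)
    (hA : ∀ a b, (∀ k, k ≠ i → (w a).1 k = (w b).1 k) → (w a).2 = (w b).2 → a.2 j = b.2 j)
    (hB : ∀ a b a' b', a.2 j = b.2 j → a'.2 j = b'.2 j →
      a.1 = a'.1 → (∀ k, k ≠ j → a.2 k = a'.2 k) →
      b.1 = b'.1 → (∀ k, k ≠ j → b.2 k = b'.2 k) →
      (∀ k, k ≠ i → (w a).1 k = (w b).1 k) → (w a).2 = (w b).2 →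
      (∀ k, k ≠ i → (w a').1 k = (w b').1 k) ∧ (w a').2 = (w b').2) :
    NoInfluence (Q.W.reindex (Q.rowSplit i) (Q.colSplit j)) := by
  have hW' : Q.W.reindex (Q.rowSplit i) (Q.colSplit j) =
      basisMap fun x => Q.rowSplit i (w ((Q.colSplit j).symm x)) := by
    ext y x
    simp only [Matrix.reindex_apply, Matrix.submatrix_apply, hW, basisMap_apply]
    exact if_congr (Equiv.eq_symm_apply _) rfl rfl
  rw [hW']
  have a₀ := hL.some
  have hcol_j : ∀ a b, ((Q.colSplit j).symm (a, b)).2 j = a := by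
    intro a b
    simp [colSplit, Equiv.piSplitAt]
  have hcol_k : ∀ a b k (hk : k ≠ j), ((Q.colSplit j).symm (a, b)).2 k = b.2 ⟨k, hk⟩ := by
    intro a b k hk
    simp [colSplit, Equiv.piSplitAt, hk]
  have hrow : ∀ p p' : (∀ i, Q.In i) × Q.S,
      (Q.rowSplit i p).1 = (Q.rowSplit i p').1 ↔
        (∀ k, k ≠ i → p.1 k = p'.1 k) ∧ p.2 = p'.2 := by
    intro p p'
    rw [Prod.ext_iff, funext_iff, Subtype.forall]
    rfl
  have hcol : ∀ a a' b k, k ≠ j →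
      ((Q.colSplit j).symm (a, b)).2 k = ((Q.colSplit j).symm (a', b)).2 k := by
    intro a a' b k hk
    rw [hcol_k _ _ _ hk, hcol_k _ _ _ hk]
  refine noInfluence_basisMap _
    ((Q.rowSplit i).injective.comp (hw.comp (Q.colSplit j).symm.injective))
    (fun b => (w ((Q.colSplit j).symm (a₀, b))).1 i) ?_ ?_ ?_
  · intro a b
    exact hg _ _ rfl (hcol _ _ _)
  · intro a b a' b' h
    rw [hrow] at h
    have := hA _ _ h.1 h.2
    rwa [hcol_j, hcol_j] at this
  · intro a a' b b' h
    rw [hrow] at h ⊢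
    exact hB ((Q.colSplit j).symm (a, b)) ((Q.colSplit j).symm (a, b')) _ _
      (by rw [hcol_j, hcol_j]) (by rw [hcol_j, hcol_j]) rfl (hcol _ _ _) rfl
      (hcol _ _ _) h.1 h.2

/-- The contribution of a single node to the normalisation: if both paths have the same output,
a channel forces its inputs `f l`, `f' l'` to agree. -/
theorem sum_channel_mul_state {A B L : Type} [Fintype A] [Fintype B] [Fintype L]
    [DecidableEq A] [DecidableEq B] {τ : Matrix (B × A) (B × A) ℂ} (hτ : IsChannelOp τ)
    {ρ : Matrix L L ℂ} (hρ : IsState ρ) (C : L → L → Prop) [∀ l l', Decidable (C l l')]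
    (P : Prop) [Decidable P] [DecidableEq L] (f f' : L → A)
    (h : ∀ l l', (C l l' ∧ f l = f' l') ↔ (l = l' ∧ P)) :
    ∑ x : (B × B) × (L × L), (if x.1.1 = x.1.2 then
      (if C x.2.1 x.2.2 then ρ x.2.1 x.2.2 * τ (x.1.2, f' x.2.2) (x.1.1, f x.2.1) else 0)
      else 0) = if P then 1 else 0 := by
  have hl : ∀ l l', ∑ o, (if C l l' then ρ l l' * τ (o, f' l') (o, f l) else 0) =
      if l = l' then (if P then ρ l l' else 0) else 0 := by
    intro l l'
    have h := h l l'
    have h₁ := hτ.2 (f' l') (f l)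
    rw [Matrix.one_apply] at h₁
    by_cases hC : C l l'
    · simp only [hC, if_true, ← Finset.mul_sum, h₁]
      by_cases hf : f l = f' l'
      · have h₂ := h.1 ⟨hC, hf⟩
        rw [if_pos hf.symm, if_pos h₂.1, if_pos h₂.2, mul_one]
      · rw [if_neg fun h => hf h.symm, mul_zero, ← ite_and, if_neg fun h₂ => hf (h.2 h₂).2]
    · rw [← ite_and, if_neg fun h₂ => hC (h.2 h₂).1]
      simp [hC]
  have htr : ∑ l, ρ l l = 1 := hρ.2
  rw [Fintype.sum_prod_type_right, Fintype.sum_prod_type]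
  simp only [Fintype.sum_prod_type, Finset.sum_ite_eq, Finset.mem_univ, if_true, hl]
  split_ifs
  · exact htr
  · simp

/-- Normalisation of an acyclic process whose unitary permutes the basis states by `w`. Two
computational paths `a`, `a'` interfere if they agree in the sink, which means `C i` and `D i` at
every node; `e j i` says that the outputs of node `j` agree on what is sent to node `i`.
Agreement on `D i` and on everything sent elsewhere is agreement of the whole output of `i`, so
that a channel there contributes agreement of its inputs; by reversibility, this and `C i` amount
to agreement of the exogenous state of `i` and of everything sent to `i`. -/
theorem trace_reduce_eq_one_of_acyclic (Q : QSMData I) (hL : ∀ i, Nonempty (Q.Lin i))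
    (w : (∀ i, Q.Out i) × (∀ i, Q.Lout i) → (∀ i, Q.In i) × Q.S) (hW : Q.W = basisMap w)
    (Pa : I → Finset I) (acyclic : ∀ i, ¬ Relation.TransGen (fun j k => j ∈ Pa k) i i)
    (e : ∀ j, I → Q.Out j → Q.Out j → Prop) (D : ∀ i, Q.Out i → Q.Out i → Prop)
    (C : I → (∀ i, Q.Out i) × (∀ i, Q.Lout i) → (∀ i, Q.Out i) × (∀ i, Q.Lout i) → Prop)
    (hne : ∀ i, Nonempty (Q.Out i)) (hne' : ∀ i, Nonempty (Q.Lout i))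
    (hsink : ∀ a a', (w a).2 = (w a').2 ↔ ∀ i, C i a a' ∧ D i (a.1 i) (a'.1 i))
    (he : ∀ j k o o', j ∉ Pa k → e j k o o')
    (hD : ∀ i o o', (D i o o' ∧ ∀ k, e i k o o') ↔ o = o')
    (hC : ∀ i a a' b b', a.2 i = b.2 i → (∀ j ∈ Pa i, a.1 j = b.1 j) →
      a'.2 i = b'.2 i → (∀ j ∈ Pa i, a'.1 j = b'.1 j) → (C i a a' ↔ C i b b'))
    (hin : ∀ i a b, a.2 i = b.2 i → (∀ j ∈ Pa i, a.1 j = b.1 j) → (w a).1 i = (w b).1 i)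
    (hinv : ∀ i a a', (C i a a' ∧ (w a).1 i = (w a').1 i) ↔
      (a.2 i = a'.2 i ∧ ∀ j, e j i (a.1 j) (a'.1 j)))
    (ρ : ∀ i, Matrix (Q.Lout i) (Q.Lout i) ℂ)
    (τ : ∀ i, Matrix (Q.Out i × Q.In i) (Q.Out i × Q.In i) ℂ)
    (hτ : ∀ i, IsChannelOp (τ i)) (hρ : ∀ i, IsState (ρ i)) :
    (Q.reduce (Q.exoTensor fun i => Q.prepOp i (ρ i)) * Q.nodeTensor τ).trace = 1 := by
  classical
  rw [Q.trace_reduce_mul_nodeTensor hL w hW]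
  -- The configuration of a node consists of its part of the first and of the second path.
  let K : I → Type := fun i => (Q.Out i × Q.Out i) × (Q.Lout i × Q.Lout i)
  let fst : (∀ i, K i) → (∀ i, Q.Out i) × (∀ i, Q.Lout i) := fun c =>
    (fun i => (c i).1.1, fun i => (c i).2.1)
  let snd : (∀ i, K i) → (∀ i, Q.Out i) × (∀ i, Q.Lout i) := fun c =>
    (fun i => (c i).1.2, fun i => (c i).2.2)
  let H : I → (∀ i, K i) → ℂ := fun i c =>
    if C i (fst c) (snd c) ∧ D i (c i).1.1 (c i).1.2 then
      ρ i (c i).2.1 (c i).2.2 * τ i ((c i).1.2, (w (snd c)).1 i) ((c i).1.1, (w (fst c)).1 i)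
    else 0
  let E : ∀ j : I, I → K j → ℂ := fun j k x => if e j k x.1.1 x.1.2 then 1 else 0
  let c₀ : ∀ i, K i := fun i => (((hne i).some, (hne i).some), ((hne' i).some, (hne' i).some))
  have irrefl : ∀ i, i ∉ Pa i := fun i hi => acyclic i (Relation.TransGen.single hi)
  have hupd : ∀ (i k : I) (c : ∀ i, K i) x, k ≠ i → Function.update c i x k = c k :=
    fun i k c x hk => Function.update_of_ne hk _ _
  calc ∑ a, ∑ a', (if (w a).2 = (w a').2 then
          ∏ i, (ρ i (a.2 i) (a'.2 i) * τ i (a'.1 i, (w a').1 i) (a.1 i, (w a).1 i)) else 0)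
      = ∑ c, ∏ i, H i c := by
        rw [← Fintype.sum_prod_type' fun a a' => if (w a).2 = (w a').2 then
          ∏ i, (ρ i (a.2 i) (a'.2 i) * τ i (a'.1 i, (w a').1 i) (a.1 i, (w a).1 i)) else 0]
        refine (Fintype.sum_equiv
          ⟨fun c => (fst c, snd c), fun p i => ((p.1.1 i, p.2.1 i), (p.1.2 i, p.2.2 i)),
            fun _ => rfl, fun _ => rfl⟩ _ _ fun c => ?_).symm
        simp only [H, Equiv.coe_fn_mk, Finset.prod_ite_zero, Finset.mem_univ, true_imp_iff]
        exact if_congr (hsink _ _).symm rfl rfl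
    _ = 1 := by
        refine sum_prod_eq_one_of_acyclic Pa acyclic H E c₀ ?_ ?_ ?_ ?_
        · intro k i c x hk hik
          have h₁ : ∀ j ∈ Pa k, Function.update c i x j = c j := fun j hj =>
            hupd _ _ _ _ fun h => hik (h ▸ hj)
          have h₂ := hupd i k c x hk
          have hf : (w (fst (Function.update c i x))).1 k = (w (fst c)).1 k :=
            hin k _ _ (by simp only [fst, h₂]) fun j hj => by simp only [fst, h₁ j hj]
          have hs : (w (snd (Function.update c i x))).1 k = (w (snd c)).1 k :=
            hin k _ _ (by simp only [snd, h₂]) fun j hj => by simp only [snd, h₁ j hj]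
          have hCC : C k (fst (Function.update c i x)) (snd (Function.update c i x)) ↔
              C k (fst c) (snd c) :=
            hC k _ _ _ _ (by simp only [fst, h₂]) (fun j hj => by simp only [fst, h₁ j hj])
              (by simp only [snd, h₂]) (fun j hj => by simp only [snd, h₁ j hj])
          simp only [H, hCC, hf, hs, h₂]
        · intro j k x hj
          simp only [E, he j k _ _ hj, if_true]
        · intro j k
          have := ((hD j (c₀ j).1.1 (c₀ j).1.2).2 rfl).2 k
          simp only [E, this, if_true]
        · intro i c
          let A : Q.Lout i → (∀ i, Q.Out i) × (∀ i, Q.Lout i) := fun l =>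
            ((fst c).1, Function.update (fst c).2 i l)
          let A' : Q.Lout i → (∀ i, Q.Out i) × (∀ i, Q.Lout i) := fun l =>
            ((snd c).1, Function.update (snd c).2 i l)
          have hloc : ∀ x j, j ∈ Pa i → Function.update c i x j = c j := fun x j hj =>
            hupd _ _ _ _ fun h => irrefl i (h ▸ hj)
          have hf : ∀ x, (w (fst (Function.update c i x))).1 i = (w (A x.2.1)).1 i := fun x =>
            hin i _ _ (by simp only [fst, A, Function.update_self]) fun j hj => by
              simp only [fst, A, hloc x j hj]
          have hs : ∀ x, (w (snd (Function.update c i x))).1 i = (w (A' x.2.2)).1 i := fun x =>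
            hin i _ _ (by simp only [snd, A', Function.update_self]) fun j hj => by
              simp only [snd, A', hloc x j hj]
          have hCC : ∀ x, C i (fst (Function.update c i x)) (snd (Function.update c i x)) ↔
              C i (A x.2.1) (A' x.2.2) := fun x =>
            hC i _ _ _ _ (by simp only [fst, A, Function.update_self])
              (fun j hj => by simp only [fst, A, hloc x j hj])
              (by simp only [snd, A', Function.update_self])
              (fun j hj => by simp only [snd, A', hloc x j hj])
          have hprod : ∀ x : K i, ∏ k, E i k x = if ∀ k, e i k x.1.1 x.1.2 then 1 else 0 := by
            intro x
            simp only [E, Finset.prod_ite_zero, Finset.mem_univ, true_imp_iff,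
              Finset.prod_const_one]
          have hterm : ∀ x : K i, H i (Function.update c i x) * ∏ k, E i k x =
              if x.1.1 = x.1.2 then (if C i (A x.2.1) (A' x.2.2) then ρ i x.2.1 x.2.2 *
                τ i (x.1.2, (w (A' x.2.2)).1 i) (x.1.1, (w (A x.2.1)).1 i) else 0) else 0 := by
            intro x
            simp only [H, hCC, hf, hs, hprod, Function.update_self, ← hD]
            by_cases h₁ : C i (A x.2.1) (A' x.2.2) <;> by_cases h₂ : D i x.1.1 x.1.2 <;>
              by_cases h₃ : ∀ k, e i k x.1.1 x.1.2 <;>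
              simp only [h₁, h₂, h₃, and_true, and_false, if_true, if_false, mul_one,
                mul_zero, implies_true]
          have hR : ∏ j, E j i (c j) = if ∀ j, e j i (c j).1.1 (c j).1.2 then 1 else 0 := by
            simp only [E, Finset.prod_ite_zero, Finset.mem_univ, true_imp_iff,
              Finset.prod_const_one]
          simp only [hterm, hR]
          refine sum_channel_mul_state (hτ i) (hρ i) (fun l l' => C i (A l) (A' l')) _
            (fun l => (w (A l)).1 i) (fun l => (w (A' l)).1 i) fun l l' => ?_
          rw [hinv i (A l) (A' l')]
          simp only [A, A', fst, snd, Function.update_self]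

/-- The generalised Born rule for a permutation `w` of the basis states, when the exogenous nodes
prepare basis states and the instruments do not create coherence: there is no interference, and
the sum extends over single computational paths. -/
theorem trace_reduce_single (Q : QSMData I) (hL : ∀ i, Nonempty (Q.Lin i))
    (w : (∀ i, Q.Out i) × (∀ i, Q.Lout i) → (∀ i, Q.In i) × Q.S) (hW : Q.W = basisMap w)
    (l : ∀ i, Q.Lout i) (τ : ∀ i, Matrix (Q.Out i × Q.In i) (Q.Out i × Q.In i) ℂ)
    (hτ : ∀ i o o' a a', o ≠ o' → τ i (o, a) (o', a') = 0) :
    (Q.reduce (Q.exoTensor fun i => Q.prepOp i (Matrix.single (l i) (l i) 1)) *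
      Q.nodeTensor τ).trace =
      ∑ o, ∏ i, τ i (o i, (w (o, l)).1 i) (o i, (w (o, l)).1 i) := by
  rw [Q.trace_reduce_mul_nodeTensor hL w hW]
  simp only [Fintype.sum_prod_type]
  refine Finset.sum_congr rfl fun o _ => ?_
  rw [Finset.sum_eq_single l, Finset.sum_eq_single o, Finset.sum_eq_single l]
  · simp
  · intro l' _ hl
    obtain ⟨i, hi⟩ := Function.ne_iff.1 hl
    rw [Finset.prod_eq_zero (Finset.mem_univ i), ite_self]
    simp [hi.symm]
  · simp
  · intro o' _ ho
    refine Finset.sum_eq_zero fun l' _ => ?_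
    obtain ⟨i, hi⟩ := Function.ne_iff.1 ho
    rw [Finset.prod_eq_zero (Finset.mem_univ i), ite_self]
    rw [hτ i _ _ _ _ hi, mul_zero]
  · simp
  · intro l' _ hl
    refine Finset.sum_eq_zero fun o' _ => Finset.sum_eq_zero fun l'' _ => ?_
    obtain ⟨i, hi⟩ := Function.ne_iff.1 hl
    rw [Finset.prod_eq_zero (Finset.mem_univ i), ite_self]
    simp [hi.symm]
  · simp

theorem reduce_smul (Q : QSMData I) (r : ℂ) (T : Matrix Q.ExoNodes Q.ExoNodes ℂ) :
    Q.reduce (r • T) = r • Q.reduce T := by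
  ext p q
  simp only [reduce, Matrix.smul_apply, smul_eq_mul, Finset.mul_sum]
  simp only [mul_left_comm r]

theorem reduce_add (Q : QSMData I) (T T' : Matrix Q.ExoNodes Q.ExoNodes ℂ) :
    Q.reduce (T + T') = Q.reduce T + Q.reduce T' := by
  ext p q
  simp only [reduce, Matrix.add_apply, mul_add, Finset.sum_add_distrib]

theorem reduce_zero (Q : QSMData I) : Q.reduce 0 = 0 := by
  simpa using Q.reduce_smul 0 0

theorem reduce_sum (Q : QSMData I) {J : Type} [Fintype J]
    (T : J → Matrix Q.ExoNodes Q.ExoNodes ℂ) :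
    Q.reduce (∑ j, T j) = ∑ j, Q.reduce (T j) := by
  exact map_sum (⟨⟨Q.reduce, Q.reduce_zero⟩, Q.reduce_add⟩ :
    Matrix Q.ExoNodes Q.ExoNodes ℂ →+ Matrix Q.Nodes Q.Nodes ℂ) T Finset.univ

theorem condProb_eq (Q : QSMData I) {O : I → Type} [∀ i, Fintype (O i)]
    (z : ∀ i, Instrument (Q.In i) (Q.Out i) (O i)) (B : Finset I) (o : ∀ i, O i)
    {l : ∀ i, Q.Lam i} (hl : Q.prior l ≠ 0) :
    Q.condProb z B o l =
      (Q.reduce (Q.exoTensor fun i => Q.prepOp i (Q.state i (l i))) *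
        Q.nodeTensor (Q.eventOp z B o)).trace := by
  have hl' : (Q.prior l : ℂ) ≠ 0 := by exact_mod_cast hl
  rw [condProb, sigmaCond, exoOp, reduce_smul, smul_smul, inv_mul_cancel₀ hl', one_smul]

/-- The law of total probability. -/
theorem prob_eq_sum (Q : QSMData I) {O : I → Type} [∀ i, Fintype (O i)]
    (z : ∀ i, Instrument (Q.In i) (Q.Out i) (O i)) (B : Finset I) (o : ∀ i, O i) :
    Q.prob z B o = ∑ l, (Q.prior l : ℂ) * Q.condProb z B o l := by
  rw [prob, sigma, reduce_sum, Matrix.sum_mul, Matrix.trace_sum]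
  refine Finset.sum_congr rfl fun l _ => ?_
  by_cases hl : Q.prior l = 0
  · simp [exoOp, hl, reduce_zero]
  · rw [condProb_eq Q z B o hl, exoOp, reduce_smul, Matrix.smul_mul, Matrix.trace_smul,
      smul_eq_mul]

end QSMData

/-! ### Quantum extensions are quantum structural causal models with correlated prior -/

namespace QuantumExtension

variable {I : Type} [Fintype I] [DecidableEq I] {M : PSM I}

theorem reg_nonempty (M : PSM I) (i : I) : Nonempty (Reg M i) := by
  by_cases h : ∃ j, i ∈ M.Pa j
  · obtain ⟨j, hj⟩ := h
    exact ⟨Sum.inl ⟨j, hj⟩⟩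
  · exact ⟨Sum.inr ⟨(), fun j hj => h ⟨j, hj⟩⟩⟩

theorem ket_injective (Q : QuantumExtension M) (i : I) : Function.Injective (Q.ket i) := by
  obtain ⟨r⟩ := reg_nonempty M i
  exact fun v v' h => (Q.encV i).injective (congrFun h r)

/-- The values `(vᵢ, sᵢ)` of the reversible function of `i`, when the nodes hold the registers `o`
and `l` is the exogenous value. -/
def out (Q : QuantumExtension M) (i : I) (l : Q.T i × Bits (Q.nU i)) (o : ∀ i, Q.NodeBasis i) :
    Bits (Q.nV i) × Q.S i :=
  Q.fRev i (l, fun j => o j.1 (Sum.inl ⟨i, j.2⟩))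

theorem out_inj (Q : QuantumExtension M) (i : I) {l l' : Q.T i × Bits (Q.nU i)}
    {o o' : ∀ i, Q.NodeBasis i} : Q.out i l o = Q.out i l' o' ↔
      l = l' ∧ ∀ (j : I) (h : j ∈ M.Pa i), o j (Sum.inl ⟨i, h⟩) = o' j (Sum.inl ⟨i, h⟩) := by
  rw [out, out, (Q.fRev i).apply_eq_iff_eq, Prod.ext_iff, funext_iff]
  simp

theorem circuit_fst_inl (Q : QuantumExtension M) (p i j) :
    (Q.circuit p).1 i (Sum.inl j) = (p.2 i).2 j + (Q.out i (p.2 i).1 p.1).1 := rfl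

theorem circuit_fst_inr (Q : QuantumExtension M) (p i j) :
    (Q.circuit p).1 i (Sum.inr j) = (Q.out i (p.2 i).1 p.1).1 := rfl

theorem circuit_snd_fst (Q : QuantumExtension M) (p i) :
    ((Q.circuit p).2 i).1 = (Q.out i (p.2 i).1 p.1).2 := rfl

theorem circuit_snd_snd (Q : QuantumExtension M) (p i) :
    ((Q.circuit p).2 i).2 = if h : ∀ j, i ∉ M.Pa j then p.1 i (Sum.inr ⟨(), h⟩)
      else (Q.out i (p.2 i).1 p.1).1 := rfl

theorem circuit_fst_congr (Q : QuantumExtension M) {p p'} (i : I) (h : p.2 i = p'.2 i)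
    (ho : ∀ (j : I) (h : j ∈ M.Pa i), p.1 j (Sum.inl ⟨i, h⟩) = p'.1 j (Sum.inl ⟨i, h⟩)) :
    (Q.circuit p).1 i = (Q.circuit p').1 i := by
  have : Q.out i (p.2 i).1 p.1 = Q.out i (p'.2 i).1 p'.1 := (Q.out_inj i).2 ⟨by rw [h], ho⟩
  funext r
  rcases r with r | r
  · rw [circuit_fst_inl, circuit_fst_inl, this, h]
  · rw [circuit_fst_inr, circuit_fst_inr, this]

/-- Two paths agree in the part of the sink that belongs to `i` if they agree there on the outputs
of the reversible function that are kept in the sink and, if `i` is childless, on the discarded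
output of its node. -/
theorem circuit_snd_eq_iff (Q : QuantumExtension M) {p p'} (i : I) :
    (Q.circuit p).2 i = (Q.circuit p').2 i ↔
      ((Q.out i (p.2 i).1 p.1).2 = (Q.out i (p'.2 i).1 p'.1).2 ∧
        ((∃ j, i ∈ M.Pa j) → (Q.out i (p.2 i).1 p.1).1 = (Q.out i (p'.2 i).1 p'.1).1)) ∧
      ∀ h : ∀ j, i ∉ M.Pa j, p.1 i (Sum.inr ⟨(), h⟩) = p'.1 i (Sum.inr ⟨(), h⟩) := by
  rw [Prod.ext_iff, circuit_snd_fst, circuit_snd_fst, circuit_snd_snd, circuit_snd_snd]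
  by_cases h : ∀ j, i ∉ M.Pa j
  · have h' : ¬ ∃ j, i ∈ M.Pa j := fun ⟨j, hj⟩ => h j hj
    simp [h]
  · have h' : ∃ j, i ∈ M.Pa j := by simpa using h
    simp only [h, h', dif_neg, not_false_eq_true, true_imp_iff, IsEmpty.forall_iff, and_true]

/-- The input register of `i` together with what of `i` is kept in the sink determines the
exogenous value of `i` and the registers its parents hold for it: one of them contains `vᵢ`, so
that the CNOT gates and the reversible function can be undone. -/
theorem out_and_circuit_eq_iff (Q : QuantumExtension M) {p p'} (i : I) :
    ((Q.out i (p.2 i).1 p.1).2 = (Q.out i (p'.2 i).1 p'.1).2 ∧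
        ((∃ j, i ∈ M.Pa j) → (Q.out i (p.2 i).1 p.1).1 = (Q.out i (p'.2 i).1 p'.1).1)) ∧
      (Q.circuit p).1 i = (Q.circuit p').1 i ↔
    p.2 i = p'.2 i ∧
      ∀ (j : I) (h : j ∈ M.Pa i), p.1 j (Sum.inl ⟨i, h⟩) = p'.1 j (Sum.inl ⟨i, h⟩) := by
  constructor
  · rintro ⟨⟨hs, hv'⟩, h₁⟩
    have hv : (Q.out i (p.2 i).1 p.1).1 = (Q.out i (p'.2 i).1 p'.1).1 := by
      by_cases h : ∃ j, i ∈ M.Pa j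
      · exact hv' h
      · exact congrFun h₁ (Sum.inr ⟨(), fun j hj => h ⟨j, hj⟩⟩)
    have hout := (Q.out_inj i).1 (Prod.ext hv hs)
    refine ⟨Prod.ext hout.1 (funext fun j => ?_), hout.2⟩
    have := congrFun h₁ (Sum.inl j)
    rw [circuit_fst_inl, circuit_fst_inl, hv] at this
    exact add_right_cancel this
  · rintro ⟨h, ho⟩
    have : Q.out i (p.2 i).1 p.1 = Q.out i (p'.2 i).1 p'.1 := (Q.out_inj i).2 ⟨by rw [h], ho⟩
    exact ⟨⟨by rw [this], fun _ => by rw [this]⟩, Q.circuit_fst_congr i h ho⟩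

theorem eq_of_circuit_eq (Q : QuantumExtension M) {p p'} (i : I)
    (h₁ : (Q.circuit p).1 i = (Q.circuit p').1 i) (h₂ : (Q.circuit p).2 i = (Q.circuit p').2 i) :
    p.2 i = p'.2 i ∧
      ∀ (j : I) (h : j ∈ M.Pa i), p.1 j (Sum.inl ⟨i, h⟩) = p'.1 j (Sum.inl ⟨i, h⟩) :=
  (Q.out_and_circuit_eq_iff i).1 ⟨((Q.circuit_snd_eq_iff i).1 h₂).1, h₁⟩

theorem circuit_injective (Q : QuantumExtension M) : Function.Injective Q.circuit := by
  intro p p' h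
  have key := fun i => Q.eq_of_circuit_eq i (congrFun (congrArg Prod.fst h) i)
    (congrFun (congrArg Prod.snd h) i)
  refine Prod.ext (funext fun i => funext fun r => ?_) (funext fun i => (key i).1)
  rcases r with ⟨j, hj⟩ | ⟨⟨⟩, hi⟩
  · exact (key j).2 i hj
  · exact ((Q.circuit_snd_eq_iff i).1 (congrFun (congrArg Prod.snd h) i)).2 hi

theorem circuit_surjective (Q : QuantumExtension M) : Function.Surjective Q.circuit := by
  rintro ⟨d, s⟩
  -- Some output contains `vᵢ`; the inputs are recovered by running the circuit backwards.
  let v : ∀ i, Bits (Q.nV i) := fun i =>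
    if h : ∀ j, i ∉ M.Pa j then d i (Sum.inr ⟨(), h⟩) else (s i).2
  let x := fun i => (Q.fRev i).symm (v i, (s i).1)
  let o : ∀ i, Q.NodeBasis i := fun i =>
    Sum.elim (fun k => (x k.1).2 ⟨i, k.2⟩) (fun _ => (s i).2)
  let l : ∀ i, Q.ExoBasis i := fun i => ((x i).1, fun j => d i (Sum.inl j) - v i)
  have hout : ∀ i, Q.out i (l i).1 o = (v i, (s i).1) := fun i =>
    (Q.fRev i).apply_symm_apply _
  refine ⟨(o, l), Prod.ext (funext fun i => funext fun r => ?_)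
    (funext fun i => Prod.ext ?_ ?_)⟩
  · rcases r with j | ⟨⟨⟩, hi⟩
    · rw [circuit_fst_inl, hout]
      simp [l]
    · rw [circuit_fst_inr, hout]
      simp [v, hi]
  · rw [circuit_snd_fst, hout]
  · rw [circuit_snd_snd, hout]
    split_ifs with h
    · rfl
    · simp [v, h]

theorem toQSM_W (Q : QuantumExtension M) :
    Q.toQSM.W = basisMap (B := (∀ i, Q.toQSM.In i) × Q.toQSM.S) Q.circuit := by
  ext b a
  exact (basisMap_apply (B := (∀ i, Q.toQSM.In i) × Q.toQSM.S) Q.circuit b a).symm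

/-- The prior is supported on exogenous outcomes that encode situations: its marginal vanishes on all
other bit strings, and it is nonnegative. -/
theorem exists_encU_eq (Q : QuantumExtension M) {l : ∀ i, Q.T i × Bits (Q.nU i)}
    (hl : Q.prior l ≠ 0) : ∃ u : ∀ i, M.U i, ∀ i, Q.encU i (u i) = (l i).2 := by
  by_contra! hu
  have h := Q.prior_marginal fun i => (l i).2
  rw [Finset.sum_eq_zero (s := Finset.univ (α := ∀ i, M.U i))] at h
  · have := (Finset.sum_eq_zero_iff_of_nonneg fun t _ => Q.prior_nonneg _).1 h
      (fun i => (l i).1) (Finset.mem_univ _)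
    exact hl this
  · intro u _
    rw [if_neg]
    intro e
    obtain ⟨i, hi⟩ := hu u
    exact hi (congrFun e i)

theorem enc_injective (Q : QuantumExtension M) :
    Function.Injective fun (u : ∀ i, M.U i) i => Q.encU i (u i) :=
  fun _ _ e => funext fun i => (Q.encU i).injective (congrFun e i)

/-- Averages over the prior of quantities that depend on the encoded exogenous values alone are
averages over `P(u)`. -/
theorem sum_prior_mul (Q : QuantumExtension M) (g : (∀ i, Q.T i × Bits (Q.nU i)) → ℂ)
    (G : (∀ i, M.U i) → ℂ)
    (h : ∀ l u, Q.prior l ≠ 0 → (∀ i, Q.encU i (u i) = (l i).2) → g l = G u) :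
    ∑ l, (Q.prior l : ℂ) * g l = ∑ u, (M.P u : ℂ) * G u := by
  let enc : (∀ i, M.U i) → ∀ i, Bits (Q.nU i) := fun u i => Q.encU i (u i)
  have enc_inj : Function.Injective enc := Q.enc_injective
  let G' : (∀ i, Bits (Q.nU i)) → ℂ := fun w => ∑ u, if enc u = w then G u else 0
  have hG' : ∀ u, G' (enc u) = G u := by
    intro u
    simp [G', enc_inj.eq_iff]
  have hg : ∀ l, (Q.prior l : ℂ) * g l = (Q.prior l : ℂ) * G' (fun i => (l i).2) := by
    intro l
    by_cases hl : Q.prior l = 0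
    · simp [hl]
    · obtain ⟨u, hu⟩ := Q.exists_encU_eq hl
      have hu' : (fun i => (l i).2) = enc u := funext fun i => (hu i).symm
      rw [h l u hl hu, hu', hG']
  calc ∑ l, (Q.prior l : ℂ) * g l
      = ∑ w : ∀ i, Bits (Q.nU i), (∑ t : ∀ i, Q.T i, (Q.prior fun i => (t i, w i) : ℂ)) *
          G' w := by
        simp only [hg, Finset.sum_mul]
        rw [← Fintype.sum_prod_type_right' fun (t : ∀ i, Q.T i) (w : ∀ i, Bits (Q.nU i)) =>
          (Q.prior fun i => (t i, w i) : ℂ) * G' w]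
        exact Fintype.sum_equiv
          ⟨fun l => (fun i => (l i).1, fun i => (l i).2), fun p i => (p.1 i, p.2 i),
            fun _ => rfl, fun _ => rfl⟩ _ _ fun _ => rfl
    _ = ∑ w, (∑ u, if enc u = w then (M.P u : ℂ) else 0) * G' w := by
        refine Finset.sum_congr rfl fun w _ => ?_
        rw [← Complex.ofReal_sum, Q.prior_marginal w]
        simp only [Complex.ofReal_sum, apply_ite Complex.ofReal, Complex.ofReal_zero, enc]
    _ = ∑ u, (M.P u : ℂ) * G u := by
        simp only [Finset.sum_mul]
        rw [Finset.sum_comm]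
        simp [ite_mul, hG']

theorem sum_prior (Q : QuantumExtension M) : ∑ l, Q.prior l = 1 := by
  have h := Q.sum_prior_mul (fun _ => 1) (fun _ => 1) fun _ _ _ _ => rfl
  simp only [mul_one] at h
  rw [← Complex.ofReal_sum, ← Complex.ofReal_sum, M.P_sum] at h
  exact_mod_cast h

/-- There are exogenous outcomes because their probabilities sum to `1`. -/
theorem nonempty_exoBasis (Q : QuantumExtension M) (i : I) : Nonempty (Q.ExoBasis i) := by
  obtain ⟨l⟩ : Nonempty (∀ i, Q.T i × Bits (Q.nU i)) := by
    by_contra h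
    have := not_nonempty_iff.1 h
    simpa using Q.sum_prior
  exact ⟨(l i, 0)⟩

theorem noInfluence (Q : QuantumExtension M) (i j : I) (hij : j ≠ i) :
    NoInfluence (Q.toQSM.W.reindex (Q.toQSM.rowSplit i) (Q.toQSM.colSplit j)) := by
  have hB : ∀ a b a' b' : (∀ i, Q.NodeBasis i) × (∀ i, Q.ExoBasis i),
      a.2 j = b.2 j → a'.2 j = b'.2 j →
      a.1 = a'.1 → (∀ k, k ≠ j → a.2 k = a'.2 k) →
      b.1 = b'.1 → (∀ k, k ≠ j → b.2 k = b'.2 k) →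
      (∀ k, k ≠ i → (Q.circuit a).1 k = (Q.circuit b).1 k) → (Q.circuit a).2 = (Q.circuit b).2 →
      (∀ k, k ≠ i → (Q.circuit a').1 k = (Q.circuit b').1 k) ∧
        (Q.circuit a').2 = (Q.circuit b').2 := by
    rintro ⟨o, l⟩ ⟨p, m⟩ ⟨o', l'⟩ ⟨p', m'⟩ - h' rfl ho rfl hp h₁ h₂
    -- At `j`, agreement does not depend on the exogenous value; elsewhere it is unchanged.
    have hpar := (Q.eq_of_circuit_eq j (h₁ j hij) (congrFun h₂ j)).2
    have hj : Q.out j (l' j).1 o = Q.out j (m' j).1 p :=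
      (Q.out_inj j).2 ⟨congrArg Prod.fst h', hpar⟩
    refine ⟨fun k hk => ?_, funext fun k => ?_⟩
    · by_cases hkj : k = j
      · subst hkj
        exact Q.circuit_fst_congr k h' hpar
      · rw [← Q.circuit_fst_congr (p := (o, l)) k (ho k hkj) fun _ _ => rfl,
          ← Q.circuit_fst_congr (p := (p, m)) k (hp k hkj) fun _ _ => rfl]
        exact h₁ k hk
    · have h₂ := (Q.circuit_snd_eq_iff k).1 (congrFun h₂ k)
      refine (Q.circuit_snd_eq_iff k).2 ⟨?_, h₂.2⟩
      by_cases hkj : k = j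
      · subst hkj
        exact ⟨congrArg Prod.snd hj, fun _ => congrArg Prod.fst hj⟩
      · have hl : l k = l' k := ho k hkj
        have hm : m k = m' k := hp k hkj
        have h₃ := h₂.1
        simp only [hl, hm] at h₃
        exact h₃
  exact Q.toQSM.noInfluence_reindex Q.circuit Q.toQSM_W Q.circuit_injective i j
    (Q.nonempty_exoBasis j)
    (fun _ _ h h' => Q.circuit_fst_congr i (h' i hij.symm) fun k _ => congrFun (congrFun h k) _)
    (fun _ _ h h' => (Q.eq_of_circuit_eq j (h j hij) (congrFun h' j)).1) hB

theorem normalised (Q : QuantumExtension M)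
    (τ : ∀ i, Matrix (Q.toQSM.Out i × Q.toQSM.In i) (Q.toQSM.Out i × Q.toQSM.In i) ℂ)
    (ρ : ∀ i, Matrix (Q.toQSM.Lout i) (Q.toQSM.Lout i) ℂ)
    (hτ : ∀ i, IsChannelOp (τ i)) (hρ : ∀ i, IsState (ρ i)) :
    (Q.toQSM.reduce (Q.toQSM.exoTensor fun i => Q.toQSM.prepOp i (ρ i)) *
      Q.toQSM.nodeTensor τ).trace = 1 := by
  let e : ∀ j, I → Q.NodeBasis j → Q.NodeBasis j → Prop := fun j k o o' =>
    ∀ h : j ∈ M.Pa k, o (Sum.inl ⟨k, h⟩) = o' (Sum.inl ⟨k, h⟩)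
  let D : ∀ i, Q.NodeBasis i → Q.NodeBasis i → Prop := fun i o o' =>
    ∀ h : ∀ j, i ∉ M.Pa j, o (Sum.inr ⟨(), h⟩) = o' (Sum.inr ⟨(), h⟩)
  let C : I → (∀ i, Q.NodeBasis i) × (∀ i, Q.ExoBasis i) →
      (∀ i, Q.NodeBasis i) × (∀ i, Q.ExoBasis i) → Prop := fun i p p' =>
    (Q.out i (p.2 i).1 p.1).2 = (Q.out i (p'.2 i).1 p'.1).2 ∧
      ((∃ j, i ∈ M.Pa j) → (Q.out i (p.2 i).1 p.1).1 = (Q.out i (p'.2 i).1 p'.1).1)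
  have hsink : ∀ a a', (Q.circuit a).2 = (Q.circuit a').2 ↔
      ∀ i, C i a a' ∧ D i (a.1 i) (a'.1 i) := fun a a' =>
    funext_iff.trans (forall_congr' fun i => Q.circuit_snd_eq_iff i)
  have hD : ∀ i o o', (D i o o' ∧ ∀ k, e i k o o') ↔ o = o' := by
    intro i o o'
    refine ⟨fun ⟨h, h'⟩ => funext fun r => ?_, fun h => h ▸ ⟨fun _ => rfl, fun _ _ => rfl⟩⟩
    rcases r with ⟨j, hj⟩ | ⟨⟨⟩, hi⟩
    · exact h' j hj
    · exact h hi
  have hout : ∀ i (a b : (∀ i, Q.NodeBasis i) × (∀ i, Q.ExoBasis i)), a.2 i = b.2 i →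
      (∀ j ∈ M.Pa i, a.1 j = b.1 j) → Q.out i (a.2 i).1 a.1 = Q.out i (b.2 i).1 b.1 :=
    fun i a b h h' => (Q.out_inj i).2 ⟨by rw [h], fun j hj => by rw [h' j hj]⟩
  have hC : ∀ i a a' b b', a.2 i = b.2 i → (∀ j ∈ M.Pa i, a.1 j = b.1 j) →
      a'.2 i = b'.2 i → (∀ j ∈ M.Pa i, a'.1 j = b'.1 j) → (C i a a' ↔ C i b b') := by
    intro i a a' b b' h₁ h₂ h₃ h₄
    simp only [C, hout i a b h₁ h₂, hout i a' b' h₃ h₄]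
  exact Q.toQSM.trace_reduce_eq_one_of_acyclic Q.nonempty_exoBasis Q.circuit Q.toQSM_W M.Pa
    M.acyclic e D C (fun _ => ⟨(0 : Q.NodeBasis _)⟩) Q.nonempty_exoBasis hsink
    (fun _ _ _ _ h h' => absurd h' h) hD hC
    (fun i _ _ h h' => Q.circuit_fst_congr i h fun j hj => congrFun (h' j hj) _)
    (fun i _ _ => Q.out_and_circuit_eq_iff i) ρ τ hτ hρ

theorem isCorrelatedQSM (Q : QuantumExtension M) : Q.toQSM.IsCorrelatedQSM where
  nonempty_exoIn := Q.nonempty_exoBasis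
  unitary := by
    rw [toQSM_W]
    exact isUnitaryMap_basisMap (A := (∀ i, Q.toQSM.Out i) × (∀ i, Q.toQSM.Lout i))
      (B := (∀ i, Q.toQSM.In i) × Q.toQSM.S)
      (Equiv.ofBijective Q.circuit ⟨Q.circuit_injective, Q.circuit_surjective⟩)
  normalised := Q.normalised
  noInfluence := Q.noInfluence
  state_isState i l := ⟨posSemidef_single_one _, Matrix.trace_single_eq_same _ _⟩
  prior_nonneg := Q.prior_nonneg
  prior_sum := Q.sum_prior

end QuantumExtension

/-! ### Instruments in the preferred bases and counterfactual probabilities -/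

section Instruments

variable {A : Type} [Fintype A] [DecidableEq A]

theorem Instrument.measure_apply (w a b a' b' : A) :
    (Instrument.measure A).τ w (b, a) (b', a') =
      if b = w ∧ b' = w ∧ a = w ∧ a' = w then 1 else 0 := by
  simp only [Instrument.measure, Matrix.kroneckerMap_apply, Matrix.transpose_apply,
    Matrix.single_apply]
  grind

theorem Instrument.doBasis_apply (x w a b a' b' : A) :
    (Instrument.doBasis x).τ w (b, a) (b', a') =
      if w = x ∧ b = x ∧ b' = x ∧ a = a' then 1 else 0 := by
  simp only [Instrument.doBasis]
  by_cases hw : w = x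
  · simp only [hw, if_true, true_and, Matrix.kroneckerMap_apply, Matrix.transpose_apply,
      Matrix.single_apply, Matrix.one_apply]
    grind
  · simp [hw]

end Instruments

namespace CSM

variable {I : Type} [Fintype I] [DecidableEq I]

theorem IsSolution.holds_iff {M : CSM I} {X : Finset I} {x : ∀ i, M.V i} {u : ∀ i, M.U i}
    {v : ∀ i, M.V i} (hv : M.IsSolution X x u v) (Y : Finset I) (y : ∀ i, M.V i) :
    M.Holds X x Y y u ↔ ∀ i ∈ Y, v i = y i := by
  refine ⟨fun ⟨v', hv', h⟩ => ?_, fun h => ⟨v, hv, h⟩⟩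
  rwa [(M.existsUnique_isSolution X x u).unique hv hv']

end CSM

namespace QuantumExtension

variable {I : Type} [Fintype I] [DecidableEq I] {M : PSM I}

theorem doInstr_of_mem (Q : QuantumExtension M) {X : Finset I} (x : ∀ i, M.V i) {i : I}
    (hi : i ∈ X) : Q.doInstr X x i = Instrument.doBasis (Q.ket i (x i)) := if_pos hi

theorem doInstr_of_notMem (Q : QuantumExtension M) {X : Finset I} (x : ∀ i, M.V i) {i : I}
    (hi : i ∉ X) : Q.doInstr X x i = Instrument.measure (Q.NodeBasis i) := if_neg hi

/-- The instruments measure or prepare in the preferred basis: their outputs are never in a coherent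
superposition of basis states. -/
theorem eventOp_doInstr_apply_of_ne (Q : QuantumExtension M) (X : Finset I) (x : ∀ i, M.V i)
    (B : Finset I) (o : ∀ i, Q.NodeBasis i) (i : I) {b b' : Q.NodeBasis i}
    (a a' : Q.NodeBasis i) (h : b ≠ b') :
    Q.toQSM.eventOp (Q.doInstr X x) B o i (b, a) (b', a') = 0 := by
  have key : ∀ w, (Q.doInstr X x i).τ w (b, a) (b', a') = 0 := by
    intro w
    by_cases hX : i ∈ X
    · rw [Q.doInstr_of_mem x hX]
      exact (Instrument.doBasis_apply _ _ _ _ _ _).trans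
        (if_neg fun h' => h (h'.2.1.trans h'.2.2.1.symm))
    · rw [Q.doInstr_of_notMem x hX]
      exact (Instrument.measure_apply _ _ _ _ _).trans
        (if_neg fun h' => h (h'.1.trans h'.2.1.symm))
  unfold QSMData.eventOp
  split_ifs
  · exact key _
  · rw [Matrix.sum_apply]
    exact Finset.sum_eq_zero fun w _ => key w

theorem eventOp_doInstr_apply_self (Q : QuantumExtension M) (X : Finset I) (x : ∀ i, M.V i)
    (B : Finset I) (o : ∀ i, Q.NodeBasis i) (i : I) (b a : Q.NodeBasis i) :
    Q.toQSM.eventOp (Q.doInstr X x) B o i (b, a) (b, a) =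
      if b = (if i ∈ X then Q.ket i (x i) else a) ∧ (i ∈ B → o i = b) then 1 else 0 := by
  have key : ∀ w, (Q.doInstr X x i).τ w (b, a) (b, a) =
      if b = (if i ∈ X then Q.ket i (x i) else a) ∧ w = b then 1 else 0 := by
    intro w
    by_cases hX : i ∈ X
    · rw [Q.doInstr_of_mem x hX, if_pos hX]
      have h := Instrument.doBasis_apply (Q.ket i (x i)) w a b a b
      refine h.trans ?_
      refine if_congr ?_ rfl rfl
      constructor
      · rintro ⟨rfl, rfl, -, -⟩
        exact ⟨rfl, rfl⟩
      · rintro ⟨rfl, rfl⟩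
        exact ⟨rfl, rfl, rfl, rfl⟩
    · rw [Q.doInstr_of_notMem x hX, if_neg hX]
      have h := Instrument.measure_apply w a b a b
      refine h.trans ?_
      refine if_congr ?_ rfl rfl
      constructor
      · rintro ⟨rfl, -, rfl, -⟩
        exact ⟨rfl, rfl⟩
      · rintro ⟨rfl, rfl⟩
        exact ⟨rfl, rfl, rfl, rfl⟩
  unfold QSMData.eventOp
  by_cases hB : i ∈ B
  · rw [if_pos hB, key]
    simp [hB]
  · rw [if_neg hB, Matrix.sum_apply, Finset.sum_congr rfl fun w _ => key w]
    simp [hB, ite_and]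

/-- On encoded values the circuit computes the structural functions. -/
theorem circuit_fst_ket (Q : QuantumExtension M) {l : ∀ i, Q.T i × Bits (Q.nU i)}
    (hl : Q.prior l ≠ 0) {u : ∀ i, M.U i} (hu : ∀ i, Q.encU i (u i) = (l i).2)
    (v : ∀ i, M.V i) (i : I) :
    (Q.circuit (fun i => Q.ket i (v i), fun i => (l i, 0))).1 i =
      Q.ket i (M.f i (u i) fun j => v j) := by
  have h : (Q.out i (l i) fun i => Q.ket i (v i)).1 = Q.encV i (M.f i (u i) fun j => v j) :=
    Q.fRev_lifts l hl i (u i) (hu i) fun j => v j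
  funext r
  rcases r with r | r
  · rw [circuit_fst_inl]
    simpa [ket] using h
  · exact h

/-- The outcomes of the instruments of `do(X = x)` are deterministic: conditionally on an exogenous
outcome that encodes the situation `u`, they are the encoded solution of the submodel `M_x`. -/
theorem condProb_doInstr (Q : QuantumExtension M) (X : Finset I) (x : ∀ i, M.V i)
    (B : Finset I) (o : ∀ i, Q.NodeBasis i) {l : ∀ i, Q.T i × Bits (Q.nU i)}
    (hl : Q.prior l ≠ 0) {u : ∀ i, M.U i} (hu : ∀ i, Q.encU i (u i) = (l i).2)
    {v : ∀ i, M.V i} (hv : M.IsSolution X x u v) [Decidable (∀ i ∈ B, o i = Q.ket i (v i))] :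
    Q.toQSM.condProb (Q.doInstr X x) B o l =
      if ∀ i ∈ B, o i = Q.ket i (v i) then 1 else 0 := by
  refine (Q.toQSM.condProb_eq _ _ _ hl).trans ((Q.toQSM.trace_reduce_single Q.nonempty_exoBasis
    Q.circuit Q.toQSM_W (fun i => (l i, 0)) _ fun i _ _ a a' h =>
      Q.eventOp_doInstr_apply_of_ne X x B o i a a' h).trans ?_)
  -- The only path with nonzero weight is the encoded solution.
  have hsol : ∀ p : ∀ i, Q.NodeBasis i,
      (∀ i, p i = if i ∈ X then Q.ket i (x i) else
        (Q.circuit (p, fun i => (l i, 0))).1 i) ↔ p = fun i => Q.ket i (v i) := by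
    intro p
    constructor
    · intro hp
      funext i
      induction i using (wellFounded_of_acyclic M.acyclic).induction with
      | _ i ih =>
        rw [hp i, hv i]
        split_ifs with hX
        · rfl
        · rw [← Q.circuit_fst_ket hl hu v i]
          exact Q.circuit_fst_congr i rfl fun j hj => congrFun (ih j hj) _
    · rintro rfl i
      rw [Q.circuit_fst_ket hl hu v i]
      refine (congrArg (Q.ket i) (hv i)).trans ?_
      split_ifs <;> rfl
  have hterm : ∀ p : ∀ i, Q.NodeBasis i,
      ∏ i, Q.toQSM.eventOp (Q.doInstr X x) B o i
        (p i, (Q.circuit (p, fun i => (l i, 0))).1 i)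
        (p i, (Q.circuit (p, fun i => (l i, 0))).1 i) =
      if p = (fun i => Q.ket i (v i)) then (if ∀ i ∈ B, o i = Q.ket i (v i) then 1 else 0)
        else 0 := by
    intro p
    rw [Finset.prod_congr rfl fun i _ => Q.eventOp_doInstr_apply_self X x B o i _ _,
      Finset.prod_ite_zero, Finset.prod_const_one]
    by_cases hp : p = fun i => Q.ket i (v i)
    · subst hp
      rw [if_pos rfl]
      have h := (hsol _).2 rfl
      by_cases hB : ∀ i ∈ B, o i = Q.ket i (v i)
      · rw [if_pos hB, if_pos fun i _ => ⟨h i, hB i⟩]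
      · rw [if_neg hB, if_neg fun h' => hB fun i hi => (h' i (Finset.mem_univ i)).2 hi]
    · rw [if_neg hp, if_neg fun h' => hp ((hsol p).1 fun i => (h' i (Finset.mem_univ i)).1)]
  refine (Finset.sum_congr rfl fun p _ => hterm p).trans ?_
  exact (Finset.sum_ite_eq' Finset.univ (fun i => Q.ket i (v i)) _).trans
    (if_pos (Finset.mem_univ _))

theorem observe_eq_doInstr (Q : QuantumExtension M) (x : ∀ i, M.V i) :
    Q.observe = Q.doInstr ∅ x := by
  funext i
  exact (Q.doInstr_of_notMem x (Finset.notMem_empty i)).symm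

open scoped Classical in
theorem condProb_observe (Q : QuantumExtension M) (E : Finset I) (e : ∀ i, M.V i)
    {l : ∀ i, Q.T i × Bits (Q.nU i)} (hl : Q.prior l ≠ 0) {u : ∀ i, M.U i}
    (hu : ∀ i, Q.encU i (u i) = (l i).2) :
    Q.toQSM.condProb Q.observe E (fun i => Q.ket i (e i)) l =
      if M.Observes E e u then 1 else 0 := by
  obtain ⟨v, hv, -⟩ := M.existsUnique_isSolution ∅ e u
  rw [Q.observe_eq_doInstr e, Q.condProb_doInstr ∅ e E _ hl hu hv]
  refine if_congr ?_ rfl rfl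
  rw [CSM.Observes, hv.holds_iff]
  simp only [(Q.ket_injective _).eq_iff, eq_comm]

theorem prob_observe (Q : QuantumExtension M) (E : Finset I) (e : ∀ i, M.V i) :
    Q.toQSM.prob Q.observe E (fun i => Q.ket i (e i)) = (M.evidenceProb E e : ℂ) := by
  classical
  refine (Q.toQSM.prob_eq_sum _ _ _).trans ((Q.sum_prior_mul _
    (fun u => if M.Observes E e u then 1 else 0) fun l u hl hu =>
      Q.condProb_observe E e hl hu).trans ?_)
  simp [PSM.evidenceProb, Finset.sum_filter, apply_ite Complex.ofReal]

open scoped Classical in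
theorem posterior_eq (Q : QuantumExtension M) (E : Finset I) (e : ∀ i, M.V i)
    {l : ∀ i, Q.T i × Bits (Q.nU i)} {u : ∀ i, M.U i}
    (hu : ∀ i, Q.encU i (u i) = (l i).2) :
    Q.posterior E e l =
      Q.prior l * ((if M.Observes E e u then 1 else 0) / M.evidenceProb E e) := by
  have hdef : Q.posterior E e l =
      Q.toQSM.condProb Q.observe E (fun i => Q.ket i (e i)) l * (Q.prior l : ℂ) /
        Q.toQSM.prob Q.observe E (fun i => Q.ket i (e i)) := rfl
  rw [hdef, prob_observe]
  by_cases hl : Q.prior l = 0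
  · simp [hl]
  · rw [Q.condProb_observe E e hl hu]
    ring

theorem posterior_eq_zero (Q : QuantumExtension M) (E : Finset I) (e : ∀ i, M.V i)
    {l : ∀ i, Q.T i × Bits (Q.nU i)} (hl : Q.prior l = 0) : Q.posterior E e l = 0 := by
  have hdef : Q.posterior E e l =
      Q.toQSM.condProb Q.observe E (fun i => Q.ket i (e i)) l * (Q.prior l : ℂ) /
        Q.toQSM.prob Q.observe E (fun i => Q.ket i (e i)) := rfl
  simp [hdef, hl]

theorem sum_prior_ancilla (Q : QuantumExtension M) (u : ∀ i, M.U i) :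
    ∑ t : ∀ i, Q.T i, Q.prior (fun i => (t i, Q.encU i (u i))) = M.P u := by
  rw [Q.prior_marginal fun i => Q.encU i (u i)]
  have h := fun u' => Q.enc_injective.eq_iff (a := u') (b := u)
  simp only [h]
  simp

theorem sum_posterior (Q : QuantumExtension M) (E : Finset I) (e : ∀ i, M.V i)
    (u : ∀ i, M.U i) :
    ∑ t : ∀ i, Q.T i, Q.posterior E e (fun i => (t i, Q.encU i (u i))) =
      (M.posterior E e u : ℂ) := by
  classical
  rw [Finset.sum_congr rfl fun t _ => Q.posterior_eq E e (u := u) fun _ => rfl,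
    ← Finset.sum_mul, ← Complex.ofReal_sum, sum_prior_ancilla, PSM.posterior]
  split_ifs <;> push_cast <;> ring

open scoped Classical in
/-- A do-intervention has its outcome with certainty, so conditioning on it is possible and trivial. As
`X` and `Y` are disjoint, the outcomes at `Y` are those of the projective measurements. -/
theorem cfProb_eq (Q : QuantumExtension M) {X Y : Finset I} (hXY : Disjoint X Y)
    (x y : ∀ i, M.V i) {l : ∀ i, Q.T i × Bits (Q.nU i)} (hl : Q.prior l ≠ 0)
    {u : ∀ i, M.U i} (hu : ∀ i, Q.encU i (u i) = (l i).2) :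
    Q.toQSM.cfProb (Q.doInstr X x) X (fun i => Q.ket i (x i)) Y (fun i => Q.ket i (y i)) l =
      some (if M.Holds X x Y y u then 1 else 0) := by
  obtain ⟨v, hv, -⟩ := M.existsUnique_isSolution X x u
  have hX : ∀ i ∈ X, v i = x i := fun i hi => (hv i).trans (if_pos hi)
  have h₁ : Q.toQSM.condProb (Q.doInstr X x) X (fun i => Q.ket i (x i)) l = 1 :=
    (Q.condProb_doInstr X x X _ hl hu hv).trans (if_pos fun i hi => by rw [hX i hi])
  have h₂ : Q.toQSM.condProb (Q.doInstr X x) (X ∪ Y)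
      (fun i => if i ∈ X then Q.ket i (x i) else Q.ket i (y i)) l =
      if M.Holds X x Y y u then 1 else 0 := by
    refine (Q.condProb_doInstr X x (X ∪ Y) _ hl hu hv).trans (if_congr ?_ rfl rfl)
    rw [hv.holds_iff]
    constructor
    · intro h i hi
      have := h i (Finset.mem_union_right _ hi)
      rw [if_neg (Finset.disjoint_right.1 hXY hi)] at this
      exact (Q.ket_injective i this).symm
    · intro h i hi
      by_cases hiX : i ∈ X
      · rw [if_pos hiX, hX i hiX]
      · rw [if_neg hiX, h i ((Finset.mem_union.1 hi).resolve_left hiX)]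
  have hdef : Q.toQSM.cfProb (Q.doInstr X x) X (fun i => Q.ket i (x i)) Y
      (fun i => Q.ket i (y i)) l =
      if Q.toQSM.condProb (Q.doInstr X x) X (fun i => Q.ket i (x i)) l = 0 then none
      else some (Q.toQSM.condProb (Q.doInstr X x) (X ∪ Y)
        (fun i => if i ∈ X then Q.ket i (x i) else Q.ket i (y i)) l /
        Q.toQSM.condProb (Q.doInstr X x) X (fun i => Q.ket i (x i)) l) := by
    unfold QSMData.cfProb
    congr!
  rw [hdef, h₁, h₂, if_neg one_ne_zero, div_one]

theorem counterfactual_eq (Q : QuantumExtension M) (E : Finset I) (e : ∀ i, M.V i)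
    {X Y : Finset I} (hXY : Disjoint X Y) (x y : ∀ i, M.V i) :
    Q.counterfactual E e X x Y y = some (M.counterfactual E e X x Y y : ℂ) := by
  classical
  let cf : (∀ i, Q.T i × Bits (Q.nU i)) → Option ℂ := fun l =>
    Q.toQSM.cfProb (Q.doInstr X x) X (fun i => Q.ket i (x i)) Y (fun i => Q.ket i (y i)) l
  have hpossible : ¬ ∃ l, Q.posterior E e l ≠ 0 ∧ cf l = none := by
    rintro ⟨l, hpost, hnone⟩
    have hl : Q.prior l ≠ 0 := fun h => hpost (Q.posterior_eq_zero E e h)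
    obtain ⟨u, hu⟩ := Q.exists_encU_eq hl
    have := (Q.cfProb_eq hXY x y hl hu).symm.trans hnone
    exact Option.some_ne_none _ this
  unfold counterfactual QSMData.query
  refine (if_neg hpossible).trans (congrArg some ?_)
  change ∑ l, Q.posterior E e l * (cf l).getD 0 = _
  -- The summand, with the factor `Q.prior l` split off.
  let g : (∀ i, Q.T i × Bits (Q.nU i)) → ℂ := fun l =>
    if Q.prior l = 0 then 0 else Q.posterior E e l / Q.prior l * (cf l).getD 0
  have hg : ∀ l, Q.posterior E e l * (cf l).getD 0 = Q.prior l * g l := by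
    intro l
    by_cases hl : Q.prior l = 0
    · simp [Q.posterior_eq_zero E e hl, hl]
    · have : (Q.prior l : ℂ) ≠ 0 := by exact_mod_cast hl
      simp only [g, hl, if_false]
      field_simp
  rw [Finset.sum_congr rfl fun l _ => hg l, Q.sum_prior_mul g fun u =>
    ((if M.Observes E e u then 1 else 0) / M.evidenceProb E e) *
      (if M.Holds X x Y y u then 1 else 0)]
  · rw [PSM.counterfactual, Finset.sum_filter]
    push_cast
    refine Finset.sum_congr rfl fun u _ => ?_
    rw [PSM.posterior]
    split_ifs <;> simp
    ring
  · intro l u hl hu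
    have hl' : (Q.prior l : ℂ) ≠ 0 := by exact_mod_cast hl
    have hcf : cf l = some (if M.Holds X x Y y u then 1 else 0) := Q.cfProb_eq hXY x y hl hu
    simp only [g, hl, if_false, Q.posterior_eq E e hu, hcf, Option.getD_some]
    field_simp

end QuantumExtension

/-! ### Existence of quantum extensions -/

theorem exists_embedding_bits (A : Type) [Fintype A] :
    Nonempty (A ↪ Bits (Fintype.card A)) := by
  refine Function.Embedding.nonempty_of_card_le ?_
  simpa [ZMod.card] using Nat.lt_two_pow_self.le

namespace PSM

variable {I : Type} [Fintype I] [DecidableEq I]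

/-- An arbitrary injective encoding by bit strings, one bit for each element of `A`. -/
noncomputable def bitEncoding (A : Type) [Fintype A] : A ↪ Bits (Fintype.card A) :=
  (exists_embedding_bits A).some

/-- The structural function of `i` on bit strings, extended by zero to the bit strings that encode
nothing. -/
noncomputable def bitFun (M : PSM I) (i : I) :
    Bits (Fintype.card (M.U i)) × (∀ j : {j // j ∈ M.Pa i}, Bits (Fintype.card (M.V j))) →
      Bits (Fintype.card (M.V i)) :=
  Function.extend
    (fun q : M.U i × (∀ j : {j // j ∈ M.Pa i}, M.V j) =>
      (bitEncoding (M.U i) q.1, fun j => bitEncoding (M.V j) (q.2 j)))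
    (fun q => bitEncoding (M.V i) (M.f i q.1 q.2)) 0

theorem bitFun_encode (M : PSM I) (i : I) (u : M.U i) (p : ∀ j : {j // j ∈ M.Pa i}, M.V j) :
    M.bitFun i (bitEncoding (M.U i) u, fun j => bitEncoding (M.V j) (p j)) =
      bitEncoding (M.V i) (M.f i u p) := by
  refine Function.Injective.extend_apply ?_ _ _ (u, p)
  rintro ⟨u, p⟩ ⟨u', p'⟩ h
  rw [Prod.mk.injEq] at h
  exact Prod.ext ((bitEncoding _).injective h.1)
    (funext fun j => (bitEncoding _).injective (congrFun h.2 j))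

/-- The quantum extension by the reversible functions `(t, u, pa) ↦ (t + f(u, pa), (u, pa))`, with
the ancillae `t` set to zero. -/
noncomputable def quantumExtension (M : PSM I) : QuantumExtension M where
  nV i := Fintype.card (M.V i)
  nU i := Fintype.card (M.U i)
  encV i := bitEncoding (M.V i)
  encU i := bitEncoding (M.U i)
  T i := Bits (Fintype.card (M.V i))
  S i := Bits (Fintype.card (M.U i)) × (∀ j : {j // j ∈ M.Pa i}, Bits (Fintype.card (M.V j)))
  fRev i :=
    { toFun := fun x => (x.1.1 + M.bitFun i (x.1.2, x.2), (x.1.2, x.2))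
      invFun := fun y => ((y.1 - M.bitFun i y.2, y.2.1), y.2.2)
      left_inv := fun x => by simp
      right_inv := fun y => by simp }
  prior l := if ∀ i, (l i).1 = 0 then
    ∑ u : ∀ i, M.U i, if (fun i => bitEncoding (M.U i) (u i)) = (fun i => (l i).2) then M.P u else 0
    else 0
  prior_nonneg l := by
    split_ifs
    · exact Finset.sum_nonneg fun u _ => by split_ifs <;> simp [M.P_nonneg]
    · exact le_rfl
  prior_marginal w := by
    rw [Finset.sum_eq_single 0]
    · simp
    · intro t _ ht
      exact if_neg fun h => ht (funext h)
    · simp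
  fRev_lifts l hl i u hu p := by
    have ht : (l i).1 = 0 := by
      by_contra h
      exact hl (if_neg fun h' => h (h' i))
    change (l i).1 + M.bitFun i ((l i).2, _) = _
    rw [ht, zero_add, ← hu, bitFun_encode]

theorem quantumExtension_isQSM (M : PSM I) (hM : M.Independent) :
    M.quantumExtension.toQSM.IsQSM := by
  obtain ⟨p, hp, hp_sum, hP⟩ := hM
  let q : ∀ i, Bits (Fintype.card (M.V i)) × Bits (Fintype.card (M.U i)) → ℝ := fun i l =>
    if l.1 = 0 then ∑ u, if bitEncoding (M.U i) u = l.2 then p i u else 0 else 0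
  have hq : ∀ i l, 0 ≤ q i l := by
    intro i l
    simp only [q]
    split_ifs
    · exact Finset.sum_nonneg fun u _ => by split_ifs <;> simp [hp]
    · exact le_rfl
  have hq_sum : ∀ i, ∑ l, q i l = 1 := by
    intro i
    rw [Fintype.sum_prod_type, Finset.sum_eq_single 0]
    · simp only [q, if_true]
      rw [Finset.sum_comm]
      simp [hp_sum]
    · intro t _ ht
      simp [q, ht]
    · simp
  have hprior : ∀ l : ∀ i, Bits (Fintype.card (M.V i)) × Bits (Fintype.card (M.U i)),
      M.quantumExtension.prior l = ∏ i, q i (l i) := by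
    intro l
    simp only [quantumExtension, q, Finset.prod_ite_zero, Finset.mem_univ, true_imp_iff,
      Finset.prod_univ_sum, Fintype.piFinset_univ, funext_iff, hP]
  exact ⟨M.quantumExtension.isCorrelatedQSM, q, hq, hq_sum, hprior⟩

end PSM

theorem mainTheorem2 {I : Type} [Fintype I] [DecidableEq I] (M : PSM I) :
    Nonempty (QuantumExtension M) ∧
    (M.Independent → ∃ Q : QuantumExtension M, Q.toQSM.IsQSM) ∧
    ∀ Q : QuantumExtension M,
      Q.toQSM.IsCorrelatedQSM ∧
      ∀ (E : Finset I) (e : ∀ i, M.V i), 0 < M.evidenceProb E e →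
        (∀ u : ∀ i, M.U i,
          ∑ t : ∀ i, Q.T i, Q.posterior E e (fun i => (t i, Q.encU i (u i))) =
            (M.posterior E e u : ℂ)) ∧
        ∀ (X : Finset I) (x : ∀ i, M.V i) (Y : Finset I) (y : ∀ i, M.V i), Disjoint X Y →
          Q.counterfactual E e X x Y y = some (M.counterfactual E e X x Y y : ℂ) :=
  ⟨⟨M.quantumExtension⟩, fun h => ⟨M.quantumExtension, M.quantumExtension_isQSM h⟩, fun Q =>
    ⟨Q.isCorrelatedQSM, fun E e _ => ⟨Q.sum_posterior E e, fun _ x _ y hXY =>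
      Q.counterfactual_eq E e hXY x y⟩⟩⟩
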